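/- **Conventions.** All inner products are linear in the second variable. Let $\delta_n$ ($n\in\mathbb Z$) be the standard basis of $\ell^2(\mathbb Z)$. For $t>0$ and $n\in\mathbb Z$ let $$\varphi_n^t(x)=\tfrac1{\sqrt t}\,\varphi_0\!\left(\tfrac xt-n\right),\qquad \varphi_0(x)=\max(0,1-|x|),$$ be the hat functions in $L^2(\mathbb R)$. Let $G$ be the (bounded, positive, invertible) Gram operator on $\ell^2(\mathbb Z)$ with matrix $G_{nm}=\langle\varphi_n^1,\varphi_m^1\rangle$, put $C=G^{-1/2}$, and let $\psi_n^t=\sum_{m}C_{mn}\varphi_m^t$, an orthonormal system in $L^2(\mathbb R)$. Let $U_t:\ell^2(\mathbb Z)\to L^2(\mathbb R)$ be the isometry with $U_t\delta_n=\psi_n^t$, and for $S\in\mathbb B(L^2(\mathbb R))$ put $\beta_t(S)=U_t^*SU_t\in\mathbb B(\ell^2(\mathbb Z))$. Let $C^*_u(\mathbb Z)\subset\mathbb B(\ell^2(\mathbb Z))$ be the uniform Roe algebra, i.e. the norm closure of the set of bounded operators whose matrix $(T_{nm})$ is a band matrix ($T_{nm}=0$ for $|n-m|>R$, for some $R$).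 Let $L^\infty_0(\mathbb R)$ be the norm closure of $\bigcup_N L^\infty([-N,N])$ in $L^\infty(\mathbb R)$, and let $A_0=L^\infty_0(\mathbb R)\rtimes\mathbb R$ be the crossed product by translations realized on $L^2(\mathbb R)$, that is, the $C^*$-subalgebra of $\mathbb B(L^2(\mathbb R))$ generated by the operators $$S_{f,g}(u)(x)=\int_{\mathbb R} f(x)g(y)u(x-y)\,dy,\qquad f\in L^\infty_0(\mathbb R),\ g\in C_c(\mathbb R).$$ A *continuous field of $C^*$-algebras* over a locally compact Hausdorff space $T$ is a triple $(T,A,\pi_t:A\to A_t)$, where $A$ and $A_t$ ($t\in T$) are $C^*$-algebras, each $\pi_t$ is a surjective $*$-homomorphism, the family $\{\pi_t\}_{t\in T}$ is faithful (if $\pi_t(a)=0$ for all $t\in T$ then $a=0$), and $t\mapsto\|\pi_t(a)\|$ is continuous on $T$ for every $a\in A$. **Theorem.** Let $T=[0,1]$, let $A_t=C^*_u(\mathbb Z)$ for $t\in(0,1]$, and let $A_0$ be as above. Then: 1. $\beta_t(S)\in C^*_u(\mathbb Z)$ for all $S\in A_0$ and $t\in(0,1]$. Hence for $f\in C_0((0,1];C^*_u(\mathbb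 Z))$ and $S\in A_0$ there is an element $f+\beta^S$ of the $C^*$-product $\prod_{t\in T}A_t$ (of bounded families) with value $f(t)+\beta_t(S)$ at $t\in(0,1]$ and value $S$ at $0$. 2. The function $t\mapsto f(t)+\beta_t(S)$ on $(0,1]$ determines $f$ and $S$ uniquely. 3. The set $$A=C_0((0,1];C^*_u(\mathbb Z))+\{\beta^S:S\in A_0\}\subset\prod_{t\in T}A_t$$ is a norm closed $*$-subalgebra, hence a $C^*$-algebra, there are $*$-homomorphisms $\pi_t:A\to A_t$ with $\pi_t(f+\beta^S)=f(t)+\beta_t(S)$ for $t\in(0,1]$ and $\pi_0(f+\beta^S)=S$, and the triple $(T,A,\pi_t)$ is a continuous field of $C^*$-algebras. -/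

import Mathlib

open MeasureTheory Filter Topology
open scoped ENNReal InnerProductSpace ZeroAtInfty CompactlySupported

noncomputable section

namespace RoeField

/-- The Hilbert space `L²(ℝ)` (Lebesgue measure). -/
abbrev L2R : Type := Lp ℂ 2 (volume : Measure ℝ)
/-- The Hilbert space `l²(ℤ)`. -/
abbrev l2Z : Type := lp (fun _ : ℤ => ℂ) 2

/-- The standard orthonormal basis of `l²(ℤ)`. -/
def delta (n : ℤ) : l2Z := lp.single 2 n (1 : ℂ)

/-- The hat functions `φ_n^t(x) = t^{-1/2} φ_0(x / t - n)`, where `φ_0(x) = max(0, 1 - |x|)` is the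
hat function with `φ_0(0) = 1` supported on `[-1, 1]`. (Only `t > 0` is used.) -/
def hat (t : ℝ) (n : ℤ) (x : ℝ) : ℝ := 1 / √t * max 0 (1 - |x / t - n|)

lemma hat_of_nonpos {t : ℝ} (ht : t ≤ 0) (n : ℤ) : hat t n = 0 := by
  funext x; simp [hat, Real.sqrt_eq_zero_of_nonpos ht]

lemma hat_translate {t : ℝ} (ht : 0 < t) (n : ℤ) (x : ℝ) : hat t n x = hat t 0 (x - n * t) := by
  have : (x - n * t) / t = x / t - n := by field_simp
  simp [hat, this]

lemma continuous_hat (t : ℝ) (n : ℤ) : Continuous (hat t n) := by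
  unfold hat; fun_prop

lemma hat_eq_zero {t : ℝ} {n : ℤ} {x : ℝ} (h : 1 ≤ |x / t - n|) : hat t n x = 0 := by
  simp [hat, max_eq_left (sub_nonpos.2 h)]

lemma memLp_hat (t : ℝ) (n : ℤ) :
    MemLp (fun x => (hat t n x : ℂ)) 2 (volume : Measure ℝ) := by
  rcases le_or_gt t 0 with ht | ht
  · simp [hat_of_nonpos ht]
  · refine Continuous.memLp_of_hasCompactSupport
      (Complex.continuous_ofReal.comp (continuous_hat t n)) ?_
    refine HasCompactSupport.intro (isCompact_Icc (a := t * (n - 1)) (b := t * (n + 1))) ?_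
    intro x hx
    have : hat t n x = 0 := by
      apply hat_eq_zero
      by_contra hlt
      rw [not_le, abs_lt] at hlt
      apply hx
      obtain ⟨h1, h2⟩ := hlt
      constructor
      · have : (n : ℝ) - 1 < x / t := by linarith
        rw [lt_div_iff₀ ht] at this; linarith
      · have : x / t < (n : ℝ) + 1 := by linarith
        rw [div_lt_iff₀ ht] at this; linarith
    simp [this]

/-- `φ_n^t` as an element of `L²(ℝ)`. -/
def phi (t : ℝ) (n : ℤ) : L2R := (memLp_hat t n).toLp _

lemma norm_phi_le (t : ℝ) (n : ℤ) : ‖phi t n‖ ≤ ‖phi t 0‖ := by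
  rcases le_or_gt t 0 with ht | ht
  · simp [phi, hat_of_nonpos ht]
  · rw [phi, phi, Lp.norm_toLp, Lp.norm_toLp]
    have h := eLpNorm_comp_measurePreserving (p := 2) (memLp_hat t 0).1
      (measurePreserving_sub_right (volume : Measure ℝ) (n * t))
    rw [← h]
    apply le_of_eq
    congr 2
    funext x
    simp [hat_translate ht n x]

lemma inner_phi_eq_zero (t : ℝ) {n m : ℤ} (h : 2 ≤ |n - m|) : ⟪phi t n, phi t m⟫_ℂ = 0 := by
  rw [L2.inner_def]
  apply integral_eq_zero_of_ae
  filter_upwards [(memLp_hat t n).coeFn_toLp, (memLp_hat t m).coeFn_toLp] with x h1 h2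
  have h1' : phi t n x = (hat t n x : ℂ) := h1
  have h2' : phi t m x = (hat t m x : ℂ) := h2
  rw [h1', h2']
  have key : hat t n x = 0 ∨ hat t m x = 0 := by
    by_contra hc
    push Not at hc
    have a1 : |x / t - n| < 1 := by
      by_contra hh; exact hc.1 (hat_eq_zero (not_lt.1 hh))
    have a2 : |x / t - m| < 1 := by
      by_contra hh; exact hc.2 (hat_eq_zero (not_lt.1 hh))
    have : (2 : ℝ) ≤ |(n : ℝ) - m| := by exact_mod_cast h
    rw [abs_lt] at a1 a2
    rcases abs_cases ((n : ℝ) - m) with ⟨h3, _⟩ | ⟨h3, _⟩ <;> linarith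
  rcases key with h | h <;> simp [h]

lemma norm_sum_phi_sq_le (t : ℝ) (a : ℤ → ℂ) (s : Finset ℤ) :
    ‖∑ n ∈ s, a n • phi t n‖ ^ 2 ≤ 3 * ‖phi t 0‖ ^ 2 * ∑ n ∈ s, ‖a n‖ ^ 2 := by
  set b := ‖phi t 0‖ ^ 2 with hb
  have hb0 : 0 ≤ b := by positivity
  let c : ℤ → ℤ → ℝ := fun n m => if |n - m| < 2 then 1 else 0
  have hcs : ∀ n m, c n m = c m n := fun n m => by simp only [c, abs_sub_comm]
  have hc0 : ∀ n m, 0 ≤ c n m := fun n m => by simp only [c]; split_ifs <;> norm_num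
  have hrow : ∀ n, ∑ m ∈ s, c n m ≤ 3 := by
    intro n
    simp only [c, Finset.sum_boole]
    have : (s.filter fun m => |n - m| < 2) ⊆ Finset.Icc (n - 1) (n + 1) := by
      intro m hm
      simp only [Finset.mem_filter, abs_lt] at hm
      simp only [Finset.mem_Icc]; omega
    have h2 := Finset.card_le_card this
    simp only [Int.card_Icc] at h2
    have : (s.filter fun m => |n - m| < 2).card ≤ 3 := by omega
    exact_mod_cast this
  have hterm : ∀ n m, ‖⟪a n • phi t n, a m • phi t m⟫_ℂ‖ ≤
      b * (c n m * ((‖a n‖ ^ 2 + ‖a m‖ ^ 2) / 2)) := by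
    intro n m
    by_cases hnm : |n - m| < 2
    · have hc1 : c n m = 1 := if_pos hnm
      refine (norm_inner_le_norm _ _).trans ?_
      rw [norm_smul, norm_smul, hc1, one_mul]
      have e1 := norm_phi_le t n
      have e2 := norm_phi_le t m
      have e3 : ‖phi t n‖ * ‖phi t m‖ ≤ b := by
        rw [hb, sq]; gcongr
      have e4 : ‖a n‖ * ‖a m‖ ≤ (‖a n‖ ^ 2 + ‖a m‖ ^ 2) / 2 := by
        nlinarith [sq_nonneg (‖a n‖ - ‖a m‖)]
      calc ‖a n‖ * ‖phi t n‖ * (‖a m‖ * ‖phi t m‖)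
          = (‖phi t n‖ * ‖phi t m‖) * (‖a n‖ * ‖a m‖) := by ring
        _ ≤ _ := by gcongr
    · have : ⟪phi t n, phi t m⟫_ℂ = 0 := inner_phi_eq_zero t (not_lt.1 hnm)
      rw [inner_smul_left, inner_smul_right, this]
      simp only [mul_zero, norm_zero]
      have := hc0 n m
      positivity
  have h1 : ‖∑ n ∈ s, a n • phi t n‖ ^ 2 ≤
      ∑ n ∈ s, ∑ m ∈ s, b * (c n m * ((‖a n‖ ^ 2 + ‖a m‖ ^ 2) / 2)) := by
    have : ‖∑ n ∈ s, a n • phi t n‖ ^ 2 =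
        ‖⟪∑ n ∈ s, a n • phi t n, ∑ n ∈ s, a n • phi t n⟫_ℂ‖ := by
      rw [inner_self_eq_norm_sq_to_K]; simp
    rw [this, sum_inner]
    refine (norm_sum_le _ _).trans (Finset.sum_le_sum fun n _ => ?_)
    rw [inner_sum]
    exact (norm_sum_le _ _).trans (Finset.sum_le_sum fun m _ => hterm n m)
  refine h1.trans ?_
  have h2 : ∑ n ∈ s, ∑ m ∈ s, c n m * ‖a m‖ ^ 2 = ∑ n ∈ s, ∑ m ∈ s, c n m * ‖a n‖ ^ 2 := by
    rw [Finset.sum_comm]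
    exact Finset.sum_congr rfl fun n _ => Finset.sum_congr rfl fun m _ => by rw [hcs]
  have h3 : ∑ n ∈ s, ∑ m ∈ s, b * (c n m * ((‖a n‖ ^ 2 + ‖a m‖ ^ 2) / 2)) =
      b * ∑ n ∈ s, ∑ m ∈ s, c n m * ‖a n‖ ^ 2 := by
    have : ∀ n m, b * (c n m * ((‖a n‖ ^ 2 + ‖a m‖ ^ 2) / 2)) =
        b / 2 * (c n m * ‖a n‖ ^ 2) + b / 2 * (c n m * ‖a m‖ ^ 2) := fun n m => by ring
    simp only [this, Finset.sum_add_distrib, ← Finset.mul_sum]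
    rw [h2]; ring
  rw [h3]
  have h4 : ∑ n ∈ s, ∑ m ∈ s, c n m * ‖a n‖ ^ 2 ≤ 3 * ∑ n ∈ s, ‖a n‖ ^ 2 := by
    rw [Finset.mul_sum]
    refine Finset.sum_le_sum fun n _ => ?_
    rw [← Finset.sum_mul]
    exact mul_le_mul_of_nonneg_right (hrow n) (by positivity)
  nlinarith [mul_le_mul_of_nonneg_left h4 hb0]

lemma l2Z_summable_sq (a : l2Z) : Summable fun n => ‖a n‖ ^ 2 := by
  have := (lp.memℓp a).summable (by norm_num : 0 < (2 : ℝ≥0∞).toReal)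
  simpa using this

lemma l2Z_norm_sq (a : l2Z) : ‖a‖ ^ 2 = ∑' n, ‖a n‖ ^ 2 := by
  have := lp.norm_rpow_eq_tsum (by norm_num : 0 < (2 : ℝ≥0∞).toReal) a
  simpa using this

lemma summable_phi (t : ℝ) (a : l2Z) : Summable fun n => a n • phi t n := by
  rw [summable_iff_vanishing_norm]
  intro ε hε
  obtain ⟨s, hs⟩ := summable_iff_vanishing_norm.1 (l2Z_summable_sq a)
    (ε ^ 2 / (3 * ‖phi t 0‖ ^ 2 + 1)) (by positivity)
  refine ⟨s, fun u hu => ?_⟩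
  have h1 := norm_sum_phi_sq_le t a u
  have h2 := hs u hu
  have h0 : 0 ≤ ∑ n ∈ u, ‖a n‖ ^ 2 := by positivity
  rw [Real.norm_of_nonneg h0, lt_div_iff₀ (by positivity)] at h2
  refine lt_of_pow_lt_pow_left₀ 2 hε.le (lt_of_le_of_lt h1 ?_)
  nlinarith

/-- The bounded operator `l²(ℤ) → L²(ℝ)`, `a ↦ ∑ a_n φ_n^t`. -/
def synthesis (t : ℝ) : l2Z →L[ℂ] L2R :=
  LinearMap.mkContinuous
    { toFun := fun a => ∑' n, a n • phi t n
      map_add' := fun a b => by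
        rw [← (summable_phi t a).tsum_add (summable_phi t b)]
        simp [add_smul]
      map_smul' := fun c a => by
        rw [RingHom.id_apply, ← (summable_phi t a).tsum_const_smul c]
        simp [mul_smul] }
    (√3 * ‖phi t 0‖) (fun a => by
      have h : ∀ s : Finset ℤ, ‖∑ n ∈ s, a n • phi t n‖ ≤ √3 * ‖phi t 0‖ * ‖a‖ := by
        intro s
        refine le_of_sq_le_sq ?_ (by positivity)
        refine (norm_sum_phi_sq_le t a s).trans ?_
        rw [mul_pow, mul_pow, Real.sq_sqrt (by norm_num), l2Z_norm_sq]
        gcongr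
        exact (l2Z_summable_sq a).sum_le_tsum s (fun _ _ => by positivity)
      exact le_of_tendsto (summable_phi t a).hasSum.norm (Eventually.of_forall h))


/-- The Gram operator on `l²(ℤ)`; its matrix is `⟨φ_n, φ_m⟩`, see `gram_matrix`. -/
def gram : l2Z →L[ℂ] l2Z := (ContinuousLinearMap.adjoint (synthesis 1)) ∘L synthesis 1

/-- The operator `T^{-1/2}` of the continuous functional calculus. -/
def invSqrt {H : Type*} [NormedAddCommGroup H] [InnerProductSpace ℂ H] [CompleteSpace H]
    (T : H →L[ℂ] H) : H →L[ℂ] H :=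
  CFC.rpow T (-(1 / 2) : ℝ)

/-- `C = G^{-1/2}`. -/
def cMat : l2Z →L[ℂ] l2Z := invSqrt gram

/-- The operator `U_t : l²(ℤ) → L²(ℝ)`, `δ_n ↦ ψ_n^t`, see `U_delta`. -/
def U (t : ℝ) : l2Z →L[ℂ] L2R := synthesis t ∘L cMat

/-- The orthonormalized system `ψ_n^t = ∑_m C_{mn} φ_m^t`. -/
def psi (t : ℝ) (n : ℤ) : L2R := ∑' m : ℤ, ⟪delta m, cMat (delta n)⟫_ℂ • phi t m

lemma inner_delta (n : ℤ) (a : l2Z) : ⟪delta n, a⟫_ℂ = a n := by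
  simp [delta, lp.inner_single_left]

lemma synthesis_delta (t : ℝ) (n : ℤ) : synthesis t (delta n) = phi t n := by
  change ∑' m, (delta n : l2Z) m • phi t m = _
  rw [tsum_eq_single n]
  · simp [delta]
  · intro m hm
    simp [delta, lp.single_apply, hm]

lemma U_delta (t : ℝ) (n : ℤ) : U t (delta n) = psi t n := by
  change ∑' m, (cMat (delta n) : l2Z) m • phi t m = _
  simp [psi, inner_delta]

lemma gram_matrix (n m : ℤ) : ⟪delta n, gram (delta m)⟫_ℂ = ⟪phi 1 n, phi 1 m⟫_ℂ := by
  simp [gram, ContinuousLinearMap.adjoint_inner_right, synthesis_delta]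

/-- `β_t(S) = U_t^* S U_t`; its matrix is `⟨ψ_n^t, S ψ_m^t⟩`, see `beta_matrix`. -/
def beta (t : ℝ) (S : L2R →L[ℂ] L2R) : l2Z →L[ℂ] l2Z :=
  ContinuousLinearMap.adjoint (U t) ∘L S ∘L U t

lemma beta_matrix (t : ℝ) (S : L2R →L[ℂ] L2R) (n m : ℤ) :
    ⟪delta n, beta t S (delta m)⟫_ℂ = ⟪psi t n, S (psi t m)⟫_ℂ := by
  simp [beta, ContinuousLinearMap.adjoint_inner_right, U_delta]

/-- Finite propagation for an operator on `l²(ℤ)`: its matrix is a band matrix. -/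
def FinProp (T : l2Z →L[ℂ] l2Z) : Prop :=
  ∃ R : ℕ, ∀ n m : ℤ, (R : ℤ) < |n - m| → ⟪delta n, T (delta m)⟫_ℂ = 0

/-- The `*`-algebra of all finite propagation operators on `l²(ℤ)`. (On `l²(ℤ)` every bounded operator is
locally compact, as functions of finite support act by finite rank operators.) -/
def finPropAlg : NonUnitalStarSubalgebra ℂ (l2Z →L[ℂ] l2Z) where
  carrier := {T | FinProp T}
  zero_mem' := ⟨0, by simp⟩
  add_mem' := by
    rintro A B ⟨R, hR⟩ ⟨R', hR'⟩
    refine ⟨max R R', fun n m h => ?_⟩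
    push_cast at h
    rw [add_apply, inner_add_right, hR n m (by omega), hR' n m (by omega),
      add_zero]
  smul_mem' := by
    rintro c A ⟨R, hR⟩
    refine ⟨R, fun n m h => ?_⟩
    rw [smul_apply, inner_smul_right, hR n m h, mul_zero]
  mul_mem' := by
    rintro A B ⟨R, hR⟩ ⟨R', hR'⟩
    refine ⟨R + R', fun n m h => ?_⟩
    change ⟪delta n, A (B (delta m))⟫_ℂ = 0
    rw [← ContinuousLinearMap.adjoint_inner_left, lp.inner_eq_tsum]
    refine (tsum_congr fun k => ?_).trans tsum_zero
    by_cases hk : (R' : ℤ) < |k - m|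
    · rw [← inner_delta k (B (delta m)), hR' k m hk, inner_zero_right]
    · have hk' : (R : ℤ) < |n - k| := by
        push_cast at h
        have := abs_sub_le n k m
        omega
      have h0 : (ContinuousLinearMap.adjoint A (delta n) : l2Z) k = 0 := by
        rw [← inner_delta, ContinuousLinearMap.adjoint_inner_right, ← inner_conj_symm,
          hR n k hk', map_zero]
      rw [h0, inner_zero_left]
  star_mem' := by
    rintro A ⟨R, hR⟩
    refine ⟨R, fun n m h => ?_⟩
    rw [ContinuousLinearMap.star_eq_adjoint, ContinuousLinearMap.adjoint_inner_right,
      ← inner_conj_symm, hR m n (by rwa [abs_sub_comm]), map_zero]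

/-- The uniform Roe algebra `C*_u(ℤ)`: the norm closure of the finite propagation operators. -/
def uniformRoe : NonUnitalStarSubalgebra ℂ (l2Z →L[ℂ] l2Z) := finPropAlg.topologicalClosure

instance : IsClosed (uniformRoe : Set (l2Z →L[ℂ] l2Z)) :=
  finPropAlg.isClosed_topologicalClosure

/-- The operator of multiplication by an `L^∞` function on `L²(ℝ)`. -/
def mulOp : Lp ℂ ∞ (volume : Measure ℝ) →L[ℂ] L2R →L[ℂ] L2R :=
  (ContinuousLinearMap.mul ℂ ℂ).holderL volume ∞ 2 2

/-- The unitary translation `(λ_y u)(x) = u(x - y)` on `L²(ℝ)`. -/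
def translation (y : ℝ) : L2R →ₗᵢ[ℂ] L2R :=
  Lp.compMeasurePreservingₗᵢ ℂ (fun x => x - y) (measurePreserving_sub_right volume y)

lemma continuous_translation (u : L2R) : Continuous fun y => translation y u := by
  refine Continuous.compMeasurePreservingLp (p := 2) (f := fun _ : ℝ => u)
    (g := fun y : ℝ => (⟨fun x => x - y, by fun_prop⟩ : C(ℝ, ℝ))) continuous_const ?_
    (fun y => measurePreserving_sub_right volume y) (by norm_num)
  refine ContinuousMap.continuous_of_continuous_uncurry _ ?_
  change Continuous fun p : ℝ × ℝ => p.2 - p.1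
  fun_prop

lemma integrable_smul_translation (g : (ℝ →C_c ℂ)) (u : L2R) :
    Integrable fun y => g y • translation y u := by
  refine Continuous.integrable_of_hasCompactSupport
    (g.continuous.smul (continuous_translation u)) ?_
  exact g.hasCompactSupport.smul_right

/-- The integrated form `λ(g) = ∫ g(y) λ_y dy` of the translation representation, for `g ∈ C_c(ℝ)`. -/
def convOp (g : (ℝ →C_c ℂ)) : L2R →L[ℂ] L2R :=
  LinearMap.mkContinuous
    { toFun := fun u => ∫ y, g y • translation y u
      map_add' := fun u v => by
        rw [← integral_add (integrable_smul_translation g u) (integrable_smul_translation g v)]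
        simp
      map_smul' := fun c u => by
        rw [RingHom.id_apply, ← integral_smul]
        simp [smul_comm c] }
    (∫ y, ‖g y‖) (fun u => by
      refine (norm_integral_le_integral_norm _).trans (le_of_eq ?_)
      simp [norm_smul, integral_mul_const])


lemma translation_ae (y : ℝ) (u : L2R) : translation y u =ᵐ[volume] fun x => u (x - y) :=
  Lp.coeFn_compMeasurePreserving u (measurePreserving_sub_right volume y)

lemma integrable_conv_kernel (g : ℝ →C_c ℂ) (u : L2R) {s : Set ℝ} (hs : volume s ≠ ∞) :
    Integrable (fun p : ℝ × ℝ => g p.2 * u (p.1 - p.2)) ((volume.restrict s).prod volume) := by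
  have : IsFiniteMeasure (volume.restrict s) := ⟨by simpa using hs.lt_top⟩
  have hu2 := (Lp.memLp u)
  have hq : Measure.QuasiMeasurePreserving (fun p : ℝ × ℝ => p.1 - p.2)
      ((volume.restrict s).prod volume) (volume : Measure ℝ) :=
    (quasiMeasurePreserving_sub_of_right_invariant volume volume).mono_left
      (Measure.AbsolutelyContinuous.prod Measure.restrict_le_self.absolutelyContinuous
        Measure.AbsolutelyContinuous.rfl)
  have hmeas : AEStronglyMeasurable (fun p : ℝ × ℝ => g p.2 * u (p.1 - p.2))
      ((volume.restrict s).prod volume) :=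
    ((g.continuous.comp continuous_snd).aestronglyMeasurable).mul
      (hu2.1.comp_quasiMeasurePreserving hq)
  have hshift : ∀ y : ℝ, MemLp (fun x => u (x - y)) 2 (volume : Measure ℝ) := fun y =>
    hu2.comp_measurePreserving (measurePreserving_sub_right volume y)
  have hint : ∀ y : ℝ, IntegrableOn (fun x => u (x - y)) s := fun y =>
    ((hshift y).restrict s).integrable (by norm_num)
  have hsq : ∀ y : ℝ, Integrable (fun x => ‖u (x - y)‖ ^ 2) := fun y =>
    (hshift y).integrable_norm_pow (by norm_num)
  rw [integrable_prod_iff' hmeas]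
  refine ⟨Eventually.of_forall fun y => (hint y).const_mul (g y), ?_⟩
  refine Integrable.mono' (g := fun y => ‖g y‖ * (volume.real s + ∫ x, ‖u x‖ ^ 2)) ?_
    hmeas.norm.prod_swap.integral_prod_right' ?_
  · exact (g.continuous.norm.integrable_of_hasCompactSupport g.hasCompactSupport.norm).mul_const _
  · refine Eventually.of_forall fun y => ?_
    rw [Real.norm_of_nonneg (by positivity)]
    simp only [norm_mul]
    rw [integral_const_mul]
    gcongr
    have h1 : ∫ x in s, ‖u (x - y)‖ ≤ ∫ x in s, (1 + ‖u (x - y)‖ ^ 2) := by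
      refine integral_mono (hint y).norm ((integrable_const _).add (hsq y).integrableOn) ?_
      intro x
      dsimp only
      nlinarith [sq_nonneg (‖u (x - y)‖ - 1), sq_nonneg (‖u (x - y)‖)]
    refine h1.trans ?_
    rw [integral_add (integrable_const _) (hsq y).integrableOn]
    refine add_le_add (by simp [Measure.real]) ?_
    refine (setIntegral_le_integral (hsq y) (Eventually.of_forall fun x => by positivity)).trans ?_
    rw [integral_sub_right_eq_self (fun x => ‖u x‖ ^ 2) y]

/-- The operator `convOp g` is given by the convolution formula. -/
lemma convOp_ae (g : ℝ →C_c ℂ) (u : L2R) :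
    convOp g u =ᵐ[volume] fun x => ∫ y, g y * u (x - y) := by
  refine ae_eq_of_forall_setIntegral_eq_of_sigmaFinite ?_ ?_ ?_
  · intro s _ hs
    have : IsFiniteMeasure (volume.restrict s) := ⟨by simpa using hs⟩
    exact ((Lp.memLp (convOp g u)).restrict s).integrable (by norm_num)
  · intro s _ hs
    exact (integrable_conv_kernel g u hs.ne).integral_prod_left
  · intro s hsm hs
    rw [← L2.inner_indicatorConstLp_one (𝕜 := ℂ) hsm hs.ne (convOp g u)]
    change ⟪_, ∫ y, g y • translation y u⟫_ℂ = _
    rw [← integral_inner (integrable_smul_translation g u),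
      integral_integral_swap (integrable_conv_kernel g u hs.ne)]
    refine integral_congr_ae (Eventually.of_forall fun y => ?_)
    dsimp only
    rw [inner_smul_right, L2.inner_indicatorConstLp_one hsm hs.ne, integral_const_mul]
    congr 1
    exact setIntegral_congr_ae hsm ((translation_ae y u).mono fun x hx _ => hx)

/-- The operator `M_f λ(g)` is `S_{f,g}`, `S_{f,g}(u)(x) = ∫ f(x) g(y) u(x - y) dy`. -/
lemma crossed_ae (f : Lp ℂ ∞ (volume : Measure ℝ)) (g : ℝ →C_c ℂ) (u : L2R) :
    (mulOp f ∘L convOp g) u =ᵐ[volume] fun x => ∫ y, f x * g y * u (x - y) := by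
  have h : mulOp f (convOp g u) =ᵐ[volume] fun x => f x * convOp g u x :=
    (ContinuousLinearMap.mul ℂ ℂ).coeFn_holder (r := 2) f (convOp g u)
  filter_upwards [h, convOp_ae g u] with x h1 h2
  change mulOp f (convOp g u) x = _
  rw [h1, h2, ← integral_const_mul]
  simp [mul_assoc]

/-- `L^∞_0(ℝ)`: the norm closure in `L^∞(ℝ)` of the union over `N` of `L^∞([-N, N])`. -/
def LinftyZero : Set (Lp ℂ ∞ (volume : Measure ℝ)) :=
  closure {f | ∃ N : ℕ, ∀ᵐ x : ℝ, x ∉ Set.Icc (-(N : ℝ)) N → f x = 0}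

/-- The crossed product `A_0 = L^∞_0(ℝ) ⋊ ℝ` for the translation action, realized on `L²(ℝ)` by the
covariant pair (multiplication, translation): the C*-algebra of operators generated by all
`S_{f,g} = M_f λ(g)` with `f ∈ L^∞_0(ℝ)` and `g ∈ C_c(ℝ)`. -/
def crossedProduct : NonUnitalStarSubalgebra ℂ (L2R →L[ℂ] L2R) :=
  (NonUnitalStarAlgebra.adjoin ℂ
    {T : L2R →L[ℂ] L2R | ∃ f ∈ LinftyZero, ∃ g : ℝ →C_c ℂ,
      T = mulOp f ∘L convOp g}).topologicalClosure

instance : IsClosed (crossedProduct : Set (L2R →L[ℂ] L2R)) :=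
  (NonUnitalStarAlgebra.adjoin ℂ
    {T : L2R →L[ℂ] L2R | ∃ f ∈ LinftyZero, ∃ g : ℝ →C_c ℂ,
      T = mulOp f ∘L convOp g}).isClosed_topologicalClosure

/-- A continuous field of C*-algebras over a locally compact Hausdorff space `T`: a family of
surjective `*`-homomorphisms `π_t : A → F_t` between C*-algebras which is faithful and such that
`t ↦ ‖π_t(a)‖` is continuous for all `a`. -/
structure IsContinuousField {T : Type*} [TopologicalSpace T] [T2Space T] [LocallyCompactSpace T]
    {A : Type*} [NonUnitalCStarAlgebra A] {F : T → Type*} [∀ t, NonUnitalCStarAlgebra (F t)]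
    (π : ∀ t, A →⋆ₙₐ[ℂ] F t) : Prop where
  surjective : ∀ t, Function.Surjective (π t)
  faithful : ∀ a, (∀ t, π t a = 0) → a = 0
  continuous_norm : ∀ a, Continuous fun t => ‖π t a‖

/-- The two kinds of fibres: `A_0` (`true`) and `C*_u(ℤ)` (`false`). -/
def FiberAux : Bool → Type
  | true => crossedProduct
  | false => uniformRoe

instance : ∀ b, NonUnitalCStarAlgebra (FiberAux b)
  | true => inferInstanceAs (NonUnitalCStarAlgebra crossedProduct)
  | false => inferInstanceAs (NonUnitalCStarAlgebra uniformRoe)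

open Classical in
/-- The fibres over `[0, 1]`: `A_0` for `t = 0` and `A_t = C*_u(ℤ)` for `t ≠ 0`. -/
def Fiber (t : unitInterval) : Type := FiberAux (decide (t = 0))

instance (t : unitInterval) : NonUnitalCStarAlgebra (Fiber t) :=
  inferInstanceAs (NonUnitalCStarAlgebra (FiberAux _))

def fiberAuxTrue : ∀ {b : Bool}, b = true → (FiberAux b ≃⋆ₐ[ℂ] crossedProduct)
  | true, _ => StarAlgEquiv.refl _ _

def fiberAuxFalse : ∀ {b : Bool}, b = false → (FiberAux b ≃⋆ₐ[ℂ] uniformRoe)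
  | false, _ => StarAlgEquiv.refl _ _

/-- The inclusion `(0, 1] → [0, 1]`. -/
def incl (t : Set.Ioc (0 : ℝ) 1) : unitInterval := ⟨t, t.2.1.le, t.2.2⟩

lemma incl_ne_zero (t : Set.Ioc (0 : ℝ) 1) : incl t ≠ 0 := fun h =>
  t.2.1.ne' (congrArg Subtype.val h)

/-- The identity map, identifying the fibre over `0` with `A_0`. -/
def atZero : Fiber 0 ≃⋆ₐ[ℂ] crossedProduct := fiberAuxTrue (by simp)

/-- The identity map, identifying the fibre over `t > 0` with `C*_u(ℤ)`. -/
def atPos (t : Set.Ioc (0 : ℝ) 1) : Fiber (incl t) ≃⋆ₐ[ℂ] uniformRoe :=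
  fiberAuxFalse (by simpa using incl_ne_zero t)

/-- The element `a` of the C*-product (bounded families) of the fibres is `f + β^S`: it is `S` at
`0` and `f(t) + β_t(S)` at `t > 0`. -/
def IsSection (a : lp Fiber ∞) (f : C₀(Set.Ioc (0 : ℝ) 1, uniformRoe)) (S : crossedProduct) :
    Prop :=
  atZero (a 0) = S ∧
    ∀ t : Set.Ioc (0 : ℝ) 1,
      ((atPos t (a (incl t)) : uniformRoe) : l2Z →L[ℂ] l2Z) = (f t : l2Z →L[ℂ] l2Z) + beta t S

/-- The set `A = C_0((0,1]; C*_u(ℤ)) + {β^S : S ∈ A_0}` in the C*-product of the fibres. -/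
def sectionSet : Set (lp Fiber ∞) := {a | ∃ f S, IsSection a f S}

end RoeField

end

open MeasureTheory Filter Topology
open scoped ENNReal InnerProductSpace ZeroAtInfty CompactlySupported

noncomputable section

namespace RoeField

/-! The only property of the C*-algebra `A_0` that matters is that it consists of compact operators
(`crossedProduct_le_rankOneClosure`): cut off to a bounded interval, `λ(g)` is an integral operator
whose kernel rows depend uniformly continuously on `x` in `L²`. Compact operators are handled as the
closed span of rank one operators, and strong convergence of a bounded family becomes norm
convergence after multiplication by a compact one.

The Gram matrix of the `φ_n^t` does not depend on `t` and is diagonally dominant, so a single `C =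
G^{-1/2}` makes every `U_t` an isometry. Two strong limits then suffice. For `t > 0` the map `t ↦
U_t^*` is strongly continuous, so `t ↦ β_t(S)` is norm continuous for compact `S`. As `t → 0`, the
projections `P_t = U_t U_t^*` tend strongly to `1`, since piecewise linear interpolation
approximates compactly supported continuous functions. Hence `P_t S P_t → S` in norm, which gives
`‖β_t(S)‖ → ‖S‖` (`tendsto_norm_beta`), and `β_t(R) β_t(S) - β_t(RS) = β_t(R (P_t - 1) S) → 0`
(`tendsto_beta_mul_sub`).

Consequently `A` is the set of bounded families `a` that are continuous on `(0, 1]` and satisfy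
`a(t) - β_t(a(0)) → 0`. In this form closedness and the algebra structure are direct, and continuity
of the norm at `0` and uniqueness follow from `‖β_t(S)‖ → ‖S‖`. -/

/-! ### The Gram matrix of the hat functions -/

lemma inner_phi_eq_integral (t : ℝ) (n m : ℤ) :
    ⟪phi t n, phi t m⟫_ℂ = ((∫ x, hat t n x * hat t m x : ℝ) : ℂ) := by
  rw [L2.inner_def, ← integral_complex_ofReal]
  apply integral_congr_ae
  filter_upwards [(memLp_hat t n).coeFn_toLp, (memLp_hat t m).coeFn_toLp] with x h1 h2
  have h1' : phi t n x = (hat t n x : ℂ) := h1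
  have h2' : phi t m x = (hat t m x : ℂ) := h2
  simp [h1', h2', mul_comm]

/-- In the substitution `x ↦ x / t` the Jacobian cancels the two factors `1 / √t`. This is why the
matrix `C` computed at `t = 1` orthonormalizes the system at every scale. -/
lemma inner_phi_scale {t : ℝ} (ht : 0 < t) (n m : ℤ) :
    ⟪phi t n, phi t m⟫_ℂ = ⟪phi 1 n, phi 1 m⟫_ℂ := by
  rw [inner_phi_eq_integral, inner_phi_eq_integral]
  congr 1
  have h := Measure.integral_comp_div (fun x => hat 1 n x * hat 1 m x) t
  have e : ∀ x, hat t n x * hat t m x = t⁻¹ * (hat 1 n (x / t) * hat 1 m (x / t)) := by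
    intro x
    have : 1 / √t * (1 / √t) = t⁻¹ := by
      rw [div_mul_div_comm, Real.mul_self_sqrt ht.le]; simp
    simp only [hat, Real.sqrt_one, div_one, one_mul]
    rw [← this]; ring
  simp_rw [e]
  rw [integral_const_mul, h, abs_of_pos ht, smul_eq_mul, inv_mul_cancel_left₀ ht.ne']

lemma integral_hat_zero_mul (k : ℤ) :
    ∫ x, hat 1 0 x * hat 1 k x = ∫ x in (-1 : ℝ)..1, hat 1 0 x * hat 1 k x := by
  rw [intervalIntegral.integral_of_le (by norm_num), ← integral_Icc_eq_integral_Ioc,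
    setIntegral_eq_integral_of_forall_compl_eq_zero]
  intro x hx
  rw [hat_eq_zero (n := 0), zero_mul]
  by_contra h
  rw [not_le, abs_lt] at h
  simp only [div_one, Int.cast_zero, sub_zero] at h
  exact hx ⟨h.1.le, h.2.le⟩

lemma integral_hat_sq : ∫ x, hat 1 0 x * hat 1 0 x = 2 / 3 := by
  have hc : Continuous fun x => hat 1 0 x * hat 1 0 x :=
    (continuous_hat 1 0).mul (continuous_hat 1 0)
  rw [integral_hat_zero_mul, ← intervalIntegral.integral_add_adjacent_intervals
    (hc.intervalIntegrable (-1) 0) (hc.intervalIntegrable 0 1)]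
  have h1 : ∫ x in (-1 : ℝ)..0, hat 1 0 x * hat 1 0 x = ∫ x in (-1 : ℝ)..0, (1 + x) ^ 2 := by
    refine intervalIntegral.integral_congr fun x hx => ?_
    rw [Set.uIcc_of_le (by norm_num)] at hx
    have : |x| = -x := abs_of_nonpos hx.2
    have h2 : max 0 (1 + x) = 1 + x := max_eq_right (by linarith [hx.1])
    simp [hat, this, h2, sq]
  have h2 : ∫ x in (0 : ℝ)..1, hat 1 0 x * hat 1 0 x = ∫ x in (0 : ℝ)..1, (1 - x) ^ 2 := by
    refine intervalIntegral.integral_congr fun x hx => ?_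
    rw [Set.uIcc_of_le (by norm_num)] at hx
    have : |x| = x := abs_of_nonneg hx.1
    have h2 : max 0 (1 - x) = 1 - x := max_eq_right (by linarith [hx.2])
    simp [hat, this, h2, sq]
  rw [h1, h2, intervalIntegral.integral_comp_add_left (fun x => x ^ 2),
    intervalIntegral.integral_comp_sub_left (fun x => x ^ 2), integral_pow, integral_pow]
  norm_num

lemma integral_hat_mul_hat_one : ∫ x, hat 1 0 x * hat 1 1 x = 1 / 6 := by
  have hc : Continuous fun x => hat 1 0 x * hat 1 1 x :=
    (continuous_hat 1 0).mul (continuous_hat 1 1)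
  rw [integral_hat_zero_mul, ← intervalIntegral.integral_add_adjacent_intervals
    (hc.intervalIntegrable (-1) 0) (hc.intervalIntegrable 0 1)]
  have h1 : ∫ x in (-1 : ℝ)..0, hat 1 0 x * hat 1 1 x = ∫ x in (-1 : ℝ)..0, (0 : ℝ) := by
    refine intervalIntegral.integral_congr fun x hx => ?_
    rw [Set.uIcc_of_le (by norm_num)] at hx
    have : |x - 1| = 1 - x := by rw [abs_sub_comm]; exact abs_of_nonneg (by linarith [hx.2])
    have h2 : max 0 x = 0 := max_eq_left hx.2
    simp [hat, this, h2]
  have h2 : ∫ x in (0 : ℝ)..1, hat 1 0 x * hat 1 1 x = ∫ x in (0 : ℝ)..1, (x - x ^ 2) := by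
    refine intervalIntegral.integral_congr fun x hx => ?_
    rw [Set.uIcc_of_le (by norm_num)] at hx
    have : |x| = x := abs_of_nonneg hx.1
    have h2 : max 0 (1 - x) = 1 - x := max_eq_right (by linarith [hx.2])
    have h3 : |x - 1| = 1 - x := by rw [abs_sub_comm]; exact abs_of_nonneg (by linarith [hx.2])
    have h4 : max 0 x = x := max_eq_right hx.1
    simp [hat, this, h2, h3, h4]; ring
  rw [h1, h2, intervalIntegral.integral_sub (Continuous.intervalIntegrable (by fun_prop) _ _)
    (Continuous.intervalIntegrable (by fun_prop) _ _), integral_pow]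
  norm_num

lemma inner_phi_one_shift (n m : ℤ) : ⟪phi 1 n, phi 1 m⟫_ℂ = ⟪phi 1 0, phi 1 (m - n)⟫_ℂ := by
  rw [inner_phi_eq_integral, inner_phi_eq_integral]
  congr 1
  rw [← integral_sub_right_eq_self (fun x => hat 1 0 x * hat 1 (m - n) x) (n : ℝ)]
  congr 1
  funext x
  simp [hat]

lemma inner_phi_one_self (n : ℤ) : ⟪phi 1 n, phi 1 n⟫_ℂ = 2 / 3 := by
  rw [inner_phi_one_shift, sub_self, inner_phi_eq_integral, integral_hat_sq]
  norm_num

lemma inner_phi_one_succ (n : ℤ) : ⟪phi 1 n, phi 1 (n + 1)⟫_ℂ = 1 / 6 := by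
  rw [inner_phi_one_shift, add_sub_cancel_left, inner_phi_eq_integral, integral_hat_mul_hat_one]
  norm_num

lemma norm_inner_phi_one_le {n m : ℤ} (h : n ≠ m) :
    ‖⟪phi 1 n, phi 1 m⟫_ℂ‖ ≤ if |n - m| = 1 then 1 / 6 else 0 := by
  split_ifs with h1
  · rcases (abs_eq zero_le_one).1 h1 with h2 | h2
    · obtain rfl : n = m + 1 := by omega
      rw [← inner_conj_symm, RCLike.norm_conj, inner_phi_one_succ]; norm_num
    · obtain rfl : m = n + 1 := by omega
      rw [inner_phi_one_succ]; norm_num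
  · rw [inner_phi_eq_zero, norm_zero]
    have := abs_pos.2 (sub_ne_zero.2 h)
    omega

/-- Diagonal dominance: each row has diagonal entry `2/3` and at most two other nonzero entries,
each `1/6`, so `2/3 - 2 · 1/6 = 1/3` remains. -/
lemma norm_sum_phi_one_sq_ge (a : ℤ → ℂ) (s : Finset ℤ) :
    1 / 3 * ∑ n ∈ s, ‖a n‖ ^ 2 ≤ ‖∑ n ∈ s, a n • phi 1 n‖ ^ 2 := by
  let c : ℤ → ℤ → ℝ := fun n m => if |n - m| = 1 then 1 / 6 else 0
  have hcs : ∀ n m, c n m = c m n := fun n m => by simp only [c, abs_sub_comm]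
  have hrow : ∀ n, ∑ m ∈ s, c n m ≤ 1 / 3 := by
    intro n
    simp only [c, ← Finset.sum_filter, Finset.sum_const, nsmul_eq_mul]
    have : (s.filter fun m => |n - m| = 1) ⊆ {n - 1, n + 1} := by
      intro m hm
      simp only [Finset.mem_filter, abs_eq (zero_le_one' ℤ)] at hm
      simp only [Finset.mem_insert, Finset.mem_singleton]; omega
    have h2 := (Finset.card_le_card this).trans Finset.card_le_two
    have : ((s.filter fun m => |n - m| = 1).card : ℝ) ≤ 2 := by exact_mod_cast h2
    linarith
  -- Replacing `‖a n‖ ‖a m‖` by the mean of the squares makes the off-diagonal bound symmetric, so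
  -- that only the row sums of `c` enter.
  have hterm : ∀ n m, (if n = m then 2 / 3 * ‖a n‖ ^ 2 else 0) -
      c n m * ((‖a n‖ ^ 2 + ‖a m‖ ^ 2) / 2) ≤ (⟪a n • phi 1 n, a m • phi 1 m⟫_ℂ).re := by
    intro n m
    split_ifs with h
    · subst h
      rw [inner_smul_left, inner_smul_right, inner_phi_one_self, ← mul_assoc,
        RCLike.conj_mul]
      have : c n n = 0 := by simp [c]
      rw [this]
      apply le_of_eq
      have e : ((‖a n‖ : ℂ) ^ 2 * (2 / 3)) = ((2 / 3 * ‖a n‖ ^ 2 : ℝ) : ℂ) := by push_cast; ring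
      refine Eq.trans ?_ (congrArg Complex.re e).symm
      rw [Complex.ofReal_re]; ring
    · rw [zero_sub]
      refine (neg_le_neg ?_).trans (neg_le_of_abs_le (Complex.abs_re_le_norm _))
      rw [inner_smul_left, inner_smul_right, norm_mul, norm_mul, RCLike.norm_conj]
      have e4 : ‖a n‖ * ‖a m‖ ≤ (‖a n‖ ^ 2 + ‖a m‖ ^ 2) / 2 := by
        nlinarith [sq_nonneg (‖a n‖ - ‖a m‖)]
      have e5 : ‖⟪phi 1 n, phi 1 m⟫_ℂ‖ ≤ c n m := norm_inner_phi_one_le h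
      calc ‖a n‖ * (‖a m‖ * ‖⟪phi 1 n, phi 1 m⟫_ℂ‖)
          = ‖⟪phi 1 n, phi 1 m⟫_ℂ‖ * (‖a n‖ * ‖a m‖) := by ring
        _ ≤ _ := mul_le_mul e5 e4 (by positivity) ((norm_nonneg _).trans e5)
  have h1 : ‖∑ n ∈ s, a n • phi 1 n‖ ^ 2 =
      ∑ n ∈ s, ∑ m ∈ s, (⟪a n • phi 1 n, a m • phi 1 m⟫_ℂ).re := by
    rw [← inner_self_eq_norm_sq (𝕜 := ℂ), sum_inner]
    simp [inner_sum]
  rw [h1]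
  refine le_trans ?_ (Finset.sum_le_sum fun n _ => Finset.sum_le_sum fun m _ => hterm n m)
  have h2 : ∑ n ∈ s, ∑ m ∈ s, c n m * ‖a m‖ ^ 2 = ∑ n ∈ s, ∑ m ∈ s, c n m * ‖a n‖ ^ 2 := by
    rw [Finset.sum_comm]
    exact Finset.sum_congr rfl fun n _ => Finset.sum_congr rfl fun m _ => by rw [hcs]
  have h3 : ∑ n ∈ s, ∑ m ∈ s, c n m * ((‖a n‖ ^ 2 + ‖a m‖ ^ 2) / 2) =
      ∑ n ∈ s, ∑ m ∈ s, c n m * ‖a n‖ ^ 2 := by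
    have : ∀ n m, c n m * ((‖a n‖ ^ 2 + ‖a m‖ ^ 2) / 2) =
        1 / 2 * (c n m * ‖a n‖ ^ 2) + 1 / 2 * (c n m * ‖a m‖ ^ 2) := fun n m => by ring
    simp only [this, Finset.sum_add_distrib, ← Finset.mul_sum]
    rw [h2]; ring
  have h4 : ∑ n ∈ s, ∑ m ∈ s, c n m * ‖a n‖ ^ 2 ≤ 1 / 3 * ∑ n ∈ s, ‖a n‖ ^ 2 := by
    rw [Finset.mul_sum]
    refine Finset.sum_le_sum fun n _ => ?_
    rw [← Finset.sum_mul]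
    exact mul_le_mul_of_nonneg_right (hrow n) (by positivity)
  simp only [Finset.sum_sub_distrib]
  rw [h3]
  have h5 : ∑ n ∈ s, ∑ m ∈ s, (if n = m then 2 / 3 * ‖a n‖ ^ 2 else 0) =
      2 / 3 * ∑ n ∈ s, ‖a n‖ ^ 2 := by
    rw [Finset.mul_sum]
    exact Finset.sum_congr rfl fun n hn => by simp [hn]
  rw [h5]
  linarith

lemma hasSum_synthesis (t : ℝ) (a : l2Z) : HasSum (fun n => a n • phi t n) (synthesis t a) :=
  (summable_phi t a).hasSum

lemma norm_synthesis_one_sq_ge (a : l2Z) : 1 / 3 * ‖a‖ ^ 2 ≤ ‖synthesis 1 a‖ ^ 2 := by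
  rw [l2Z_norm_sq]
  exact le_of_tendsto_of_tendsto' ((l2Z_summable_sq a).hasSum.const_mul (1 / 3 : ℝ) |>.congr
    fun s => by rw [Finset.mul_sum]) ((hasSum_synthesis 1 a).norm.pow 2)
    fun s => norm_sum_phi_one_sq_ge a s

lemma gram_nonneg : 0 ≤ gram := by
  rw [ContinuousLinearMap.nonneg_iff_isPositive]
  exact ContinuousLinearMap.isPositive_adjoint_comp_self _

/-- Coercivity: `⟪G a, a⟫ = ‖synthesis 1 a‖²` is at least `‖a‖² / 3`. -/
lemma isUnit_gram : IsUnit gram := by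
  refine ContinuousLinearMap.isUnit_of_forall_le_norm_inner_map gram (c := 1 / 3)
    (by norm_num) fun a => ?_
  have : ⟪gram a, a⟫_ℂ = (‖synthesis 1 a‖ ^ 2 : ℝ) := by
    rw [gram, ContinuousLinearMap.comp_apply, ContinuousLinearMap.adjoint_inner_left,
      inner_self_eq_norm_sq_to_K]
    simp
  rw [this, Complex.norm_real, Real.norm_of_nonneg (by positivity)]
  have := norm_synthesis_one_sq_ge a
  simpa [mul_comm] using this

lemma hasSum_delta (a : l2Z) : HasSum (fun n => a n • delta n) a := by
  have := lp.hasSum_single (p := 2) (by norm_num) a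
  convert this using 2 with n
  rw [delta, ← lp.single_smul, smul_eq_mul, mul_one]

lemma ext_delta {E : Type*} [NormedAddCommGroup E] [NormedSpace ℂ E] {A B : l2Z →L[ℂ] E}
    (h : ∀ n, A (delta n) = B (delta n)) : A = B := by
  ext1 a
  have h1 := (hasSum_delta a).mapL A
  have h2 := (hasSum_delta a).mapL B
  simp only [map_smul, h] at h1 h2
  exact h1.unique h2

lemma adjoint_synthesis_comp {t : ℝ} (ht : 0 < t) :
    ContinuousLinearMap.adjoint (synthesis t) ∘L synthesis t = gram := by
  refine ext_delta fun m => ?_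
  refine lp.ext (funext fun n => ?_)
  rw [← inner_delta, ← inner_delta, gram_matrix, ← inner_phi_scale ht]
  simp [ContinuousLinearMap.adjoint_inner_right, synthesis_delta]

/-! ### Inverse square roots and the isometries `U_t` -/

section InvSqrt

variable {H : Type*} [NormedAddCommGroup H] [InnerProductSpace ℂ H] [CompleteSpace H]

lemma isSelfAdjoint_invSqrt (T : H →L[ℂ] H) : IsSelfAdjoint (invSqrt T) :=
  .of_nonneg CFC.rpow_nonneg

lemma invSqrt_mul_self {T : H →L[ℂ] H} (h0 : 0 ≤ T) (hT : IsUnit T) :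
    invSqrt T * T = CFC.rpow T (1 / 2 : ℝ) := by
  have h : CFC.rpow T ((-(1 / 2) : ℝ) + 1) = CFC.rpow T (-(1 / 2) : ℝ) * CFC.rpow T 1 :=
    CFC.rpow_add hT
  have h1 : CFC.rpow T 1 = T := CFC.rpow_one T
  rw [h1] at h
  rw [invSqrt, ← h]
  norm_num

lemma invSqrt_mul_mul_invSqrt {T : H →L[ℂ] H} (h0 : 0 ≤ T) (hT : IsUnit T) :
    invSqrt T * T * invSqrt T = 1 := by
  have h : CFC.rpow T ((1 / 2 : ℝ) + (-(1 / 2) : ℝ)) = _ * _ := CFC.rpow_add hT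
  rw [invSqrt_mul_self h0 hT, invSqrt]
  refine h.symm.trans ?_
  rw [add_neg_cancel]
  exact CFC.rpow_zero T

lemma invSqrt_mul_invSqrt_mul {T : H →L[ℂ] H} (h0 : 0 ≤ T) (hT : IsUnit T) :
    invSqrt T * (invSqrt T * T) = 1 := by
  have h : CFC.rpow T ((-(1 / 2) : ℝ) + (1 / 2 : ℝ)) = _ * _ := CFC.rpow_add hT
  rw [invSqrt_mul_self h0 hT, invSqrt]
  refine h.symm.trans ?_
  rw [neg_add_cancel]
  exact CFC.rpow_zero T

end InvSqrt

lemma cMat_mul_gram_mul_cMat : cMat * gram * cMat = 1 :=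
  invSqrt_mul_mul_invSqrt gram_nonneg isUnit_gram

lemma adjoint_U_comp {t : ℝ} (ht : 0 < t) : ContinuousLinearMap.adjoint (U t) ∘L U t = 1 := by
  have h : ContinuousLinearMap.adjoint cMat = cMat := isSelfAdjoint_invSqrt gram
  rw [U, ContinuousLinearMap.adjoint_comp, h, ← cMat_mul_gram_mul_cMat, ← adjoint_synthesis_comp ht]
  rfl

/-- Since `C² G = 1`, orthonormalization loses nothing: every combination of the `φ_n^t` lies in the
range of `U_t`, hence is fixed by `P_t`. -/
lemma synthesis_eq_U (t : ℝ) : synthesis t = U t ∘L (cMat * gram) := by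
  have h : cMat * (cMat * gram) = 1 := invSqrt_mul_invSqrt_mul gram_nonneg isUnit_gram
  rw [U, ContinuousLinearMap.comp_assoc]
  change _ = synthesis t ∘L (cMat * (cMat * gram))
  rw [h]; rfl

lemma norm_U_apply {t : ℝ} (ht : 0 < t) (a : l2Z) : ‖U t a‖ = ‖a‖ :=
  (ContinuousLinearMap.norm_map_iff_adjoint_comp_self (U t)).2 (adjoint_U_comp ht) a

lemma norm_U_le {t : ℝ} (ht : 0 < t) : ‖U t‖ ≤ 1 :=
  (U t).opNorm_le_bound zero_le_one fun a => by rw [norm_U_apply ht, one_mul]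

lemma norm_adjoint_U_le {t : ℝ} (ht : 0 < t) : ‖ContinuousLinearMap.adjoint (U t)‖ ≤ 1 := by
  rw [LinearIsometryEquiv.norm_map]; exact norm_U_le ht

/-! ### Compact operators as the closed span of rank one operators -/

section RankOne

variable (H : Type*) [NormedAddCommGroup H] [InnerProductSpace ℂ H] [CompleteSpace H]

/-- The closed linear span of the rank one operators, i.e. the compact operators. -/
def rankOneClosure : Submodule ℂ (H →L[ℂ] H) :=
  (Submodule.span ℂ {T | ∃ x y : H, T = InnerProductSpace.rankOne ℂ x y}).topologicalClosure

variable {H}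

lemma rankOne_mem_rankOneClosure (x y : H) :
    InnerProductSpace.rankOne ℂ x y ∈ rankOneClosure H :=
  Submodule.le_topologicalClosure _ (Submodule.subset_span ⟨x, y, rfl⟩)

lemma isClosed_rankOneClosure : IsClosed (rankOneClosure H : Set (H →L[ℂ] H)) :=
  Submodule.isClosed_topologicalClosure _

/-- Serves as the induction principle for compact operators: a closed linear condition need only be
checked on rank one operators. -/
lemma rankOneClosure_le {p : Submodule ℂ (H →L[ℂ] H)} (hp : IsClosed (p : Set (H →L[ℂ] H)))
    (h : ∀ x y : H, InnerProductSpace.rankOne ℂ x y ∈ p) : rankOneClosure H ≤ p := by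
  refine Submodule.topologicalClosure_minimal _ (Submodule.span_le.2 ?_) hp
  rintro _ ⟨x, y, rfl⟩
  exact h x y

lemma mul_mem_rankOneClosure (A : H →L[ℂ] H) {K : H →L[ℂ] H} (hK : K ∈ rankOneClosure H) :
    A * K ∈ rankOneClosure H := by
  refine rankOneClosure_le (p := (rankOneClosure H).comap (LinearMap.mulLeft ℂ A))
    (isClosed_rankOneClosure.preimage (continuous_const_mul A)) (fun x y => ?_) hK
  change A ∘L _ ∈ rankOneClosure H
  rw [InnerProductSpace.comp_rankOne]
  exact rankOne_mem_rankOneClosure _ _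

lemma star_mem_rankOneClosure {K : H →L[ℂ] H} (hK : K ∈ rankOneClosure H) :
    star K ∈ rankOneClosure H := by
  refine rankOneClosure_le (p := (rankOneClosure H).comap
    (starLinearEquiv ℂ (A := H →L[ℂ] H)).toLinearMap)
    (isClosed_rankOneClosure.preimage continuous_star) (fun x y => ?_) hK
  change ContinuousLinearMap.adjoint _ ∈ rankOneClosure H
  rw [InnerProductSpace.adjoint_rankOne]
  exact rankOne_mem_rankOneClosure _ _

/-- The compact operators as a star algebra. -/
def compactAlg (H : Type*) [NormedAddCommGroup H] [InnerProductSpace ℂ H] [CompleteSpace H] :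
    NonUnitalStarSubalgebra ℂ (H →L[ℂ] H) where
  __ := rankOneClosure H
  mul_mem' := fun _ hb => mul_mem_rankOneClosure _ hb
  star_mem' := star_mem_rankOneClosure

end RankOne

/-! ### The crossed product consists of compact operators -/

lemma norm_le_of_ae_le_indicator {v : L2R} {N c : ℝ} (hN : 0 ≤ N) (hc : 0 ≤ c)
    (h : ∀ᵐ x : ℝ, ‖v x‖ ≤ (Set.Icc (-N) N).indicator (fun _ => c) x) :
    ‖v‖ ≤ c * √(2 * N) := by
  have hs : volume (Set.Icc (-N) N) ≠ ∞ := by simp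
  have h1 : ‖v‖ ≤ ‖indicatorConstLp 2 (measurableSet_Icc (a := -N) (b := N)) hs (c : ℂ)‖ := by
    refine Lp.norm_le_norm_of_ae_le ?_
    filter_upwards [h, indicatorConstLp_coeFn (p := 2) (hs := measurableSet_Icc (a := -N) (b := N))
      (hμs := hs) (c := (c : ℂ))] with x h1 h2
    rw [h2, norm_indicator_eq_indicator_norm]
    simpa [abs_of_nonneg hc] using h1
  rw [norm_indicatorConstLp (by norm_num) (by norm_num)] at h1
  have e : volume.real (Set.Icc (-N) N) = 2 * N := by
    rw [Real.volume_real_Icc_of_le (by linarith)]; ring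
  rw [e] at h1
  simpa [abs_of_nonneg hc, Real.sqrt_eq_rpow] using h1

/-- The function `y ↦ conj g(-y)` in `L²(ℝ)`. -/
def convKernel (g : ℝ →C_c ℂ) : L2R :=
  MemLp.toLp (fun y => starRingEnd ℂ (g (-y)))
    (Continuous.memLp_of_hasCompactSupport (by fun_prop)
      ((g.hasCompactSupport.comp_homeomorph (Homeomorph.neg ℝ)).comp_left (map_zero _)))

/-- After `y ↦ x - y`, the kernel row at `x` is the translate by `x` of one fixed vector in `L²`;
its continuity in `x` is the source of compactness. -/
lemma convOp_ae_inner (g : ℝ →C_c ℂ) (u : L2R) :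
    convOp g u =ᵐ[volume] fun x => ⟪translation x (convKernel g), u⟫_ℂ := by
  filter_upwards [convOp_ae g u] with x hx
  rw [hx, L2.inner_def, ← integral_sub_left_eq_self _ volume x]
  refine integral_congr_ae ?_
  have h0 : (convKernel g : ℝ → ℂ) =ᵐ[volume] fun y => starRingEnd ℂ (g (-y)) :=
    MemLp.coeFn_toLp _
  filter_upwards [translation_ae x (convKernel g),
    (measurePreserving_sub_right volume x).quasiMeasurePreserving.ae_eq_comp h0] with y h1 h2
  have h2' : convKernel g (y - x) = starRingEnd ℂ (g (-(y - x))) := h2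
  rw [h1, h2']
  simp [mul_comm]

/-- Upgrades continuity of the translation orbit at `0` to uniform continuity. -/
lemma translation_sub_norm (x y : ℝ) (u : L2R) :
    ‖translation x u - translation y u‖ = ‖translation (x - y) u - u‖ := by
  have h : translation x u = translation y (translation (x - y) u) := by
    apply Lp.ext
    filter_upwards [translation_ae x u, translation_ae y (translation (x - y) u),
      (measurePreserving_sub_right volume y).quasiMeasurePreserving.ae_eq_comp
        (translation_ae (x - y) u)] with z h1 h2 h3
    have h3' : translation (x - y) u (z - y) = u (z - y - (x - y)) := h3
    rw [h1, h2, h3']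
    congr 1; ring
  rw [h, ← map_sub, LinearIsometry.norm_map]

lemma translation_zero (u : L2R) : translation 0 u = u := by
  apply Lp.ext
  filter_upwards [translation_ae 0 u] with x hx
  rw [hx, sub_zero]

lemma mulOp_ae (f : Lp ℂ ∞ (volume : Measure ℝ)) (u : L2R) :
    mulOp f u =ᵐ[volume] fun x => f x * u x :=
  (ContinuousLinearMap.mul ℂ ℂ).coeFn_holder (r := 2) f u

/-- The indicator function of `[-N, N]` in `L^∞(ℝ)`. -/
def cutoff (N : ℝ) : Lp ℂ ∞ (volume : Measure ℝ) :=
  indicatorConstLp ∞ (measurableSet_Icc (a := -N) (b := N)) (by simp) 1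

lemma mulOp_cutoff_ae (N : ℝ) (u : L2R) :
    mulOp (cutoff N) u =ᵐ[volume] (Set.Icc (-N) N).indicator u := by
  filter_upwards [mulOp_ae (cutoff N) u, indicatorConstLp_coeFn (p := ∞)
    (hs := measurableSet_Icc (a := -N) (b := N)) (hμs := by simp) (c := (1 : ℂ))] with x h1 h2
  have h2' : cutoff N x = _ := h2
  rw [h1, h2']
  by_cases h : x ∈ Set.Icc (-N) N <;> simp [h]

/-- The indicator function of `[iδ, (i+1)δ) ∩ [-N, N]` in `L²(ℝ)`. -/
def cell (N δ : ℝ) (i : ℤ) : L2R :=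
  indicatorConstLp 2 ((measurableSet_Icc (a := -N) (b := N)).inter
    (measurableSet_Ico (a := i * δ) (b := (i + 1) * δ)))
    (ne_top_of_le_ne_top (by simp) (measure_mono Set.inter_subset_left)) 1

/-- The finite rank operator obtained by freezing the kernel row at the left end of each cell of
length `δ`; the index range contains every cell that meets `[-N, N]`. -/
lemma sum_rankOne_cell_ae {N δ : ℝ} (hδ : 0 < δ) (k : ℝ → L2R) (u : L2R) :
    (∑ i ∈ Finset.Icc ⌊-N / δ⌋ ⌊N / δ⌋,
      InnerProductSpace.rankOne ℂ (cell N δ i) (k (i * δ))) u =ᵐ[volume]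
      (Set.Icc (-N) N).indicator fun x => ⟪k (⌊x / δ⌋ * δ), u⟫_ℂ := by
  rw [_root_.sum_apply]
  have h1 : ∀ᵐ x : ℝ, ∀ i : ℤ, InnerProductSpace.rankOne ℂ (cell N δ i) (k (i * δ)) u x =
      ⟪k (i * δ), u⟫_ℂ * (Set.Icc (-N) N ∩ Set.Ico (i * δ) ((i + 1) * δ)).indicator 1 x := by
    rw [ae_all_iff]
    intro i
    rw [InnerProductSpace.rankOne_apply]
    filter_upwards [Lp.coeFn_smul (⟪k (i * δ), u⟫_ℂ) (cell N δ i), indicatorConstLp_coeFn (p := 2)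
      (hs := (measurableSet_Icc (a := -N) (b := N)).inter
        (measurableSet_Ico (a := i * δ) (b := (i + 1) * δ)))
      (hμs := ne_top_of_le_ne_top (by simp) (measure_mono Set.inter_subset_left))
      (c := (1 : ℂ))] with x h2 h3
    have h3' : cell N δ i x = _ := h3
    rw [h2, Pi.smul_apply, h3']
    rfl
  filter_upwards [h1, Lp.coeFn_finsetSum (Finset.Icc ⌊-N / δ⌋ ⌊N / δ⌋)
    fun i => InnerProductSpace.rankOne ℂ (cell N δ i) (k (i * δ)) u] with x h1 h2
  rw [h2, Finset.sum_apply]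
  simp only [h1]
  by_cases hx : x ∈ Set.Icc (-N) N
  · rw [Set.indicator_of_mem hx, Finset.sum_eq_single ⌊x / δ⌋]
    · rw [Set.indicator_of_mem, Pi.one_apply, mul_one]
      refine ⟨hx, ?_, ?_⟩
      · rw [← le_div_iff₀ hδ]; exact Int.floor_le _
      · rw [← div_lt_iff₀ hδ]; exact Int.lt_floor_add_one _
    · intro i _ hi
      rw [Set.indicator_of_notMem, mul_zero]
      rintro ⟨_, h3, h4⟩
      rw [← le_div_iff₀ hδ] at h3
      rw [← div_lt_iff₀ hδ] at h4
      exact hi (Int.floor_eq_iff.2 ⟨h3, h4⟩).symm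
    · intro h
      exfalso
      apply h
      rw [Finset.mem_Icc]
      exact ⟨Int.floor_le_floor (by gcongr; exact hx.1), Int.floor_le_floor (by gcongr; exact hx.2)⟩
  · rw [Set.indicator_of_notMem hx]
    refine Finset.sum_eq_zero fun i _ => ?_
    rw [Set.indicator_of_notMem (fun h => hx h.1), mul_zero]

/-- Freezing the rows on cells changes each of them by at most `η` in `L²`, so by Cauchy–Schwarz the
operator changes by at most `η √(2N)`. -/
lemma mulOp_cutoff_convOp_mem {N : ℝ} (hN : 0 ≤ N) (g : ℝ →C_c ℂ) :
    mulOp (cutoff N) ∘L convOp g ∈ rankOneClosure L2R := by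
  set k : ℝ → L2R := fun x => translation x (convKernel g) with hk
  rw [← SetLike.mem_coe, ← isClosed_rankOneClosure.closure_eq]
  refine Metric.mem_closure_iff.2 fun ε hε => ?_
  -- The `+ 1` covers `N = 0` and makes `η √(2N) < ε` strict.
  set η := ε / (√(2 * N) + 1) with hη
  have hη0 : 0 < η := by positivity
  obtain ⟨δ, hδ, hd⟩ := Metric.continuousAt_iff.1
    ((continuous_translation (convKernel g)).continuousAt (x := 0)) η hη0
  have hd' : ∀ x y, |x - y| < δ → ‖k x - k y‖ ≤ η := by
    intro x y hxy
    have := hd (x := x - y) (by simpa [Real.dist_eq] using hxy)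
    rw [translation_zero, dist_eq_norm] at this
    rw [hk, translation_sub_norm]
    exact this.le
  refine ⟨∑ i ∈ Finset.Icc ⌊-N / δ⌋ ⌊N / δ⌋,
      InnerProductSpace.rankOne ℂ (cell N δ i) (k (i * δ)),
    Submodule.sum_mem _ fun i _ => rankOne_mem_rankOneClosure _ _, ?_⟩
  rw [dist_eq_norm]
  refine lt_of_le_of_lt (ContinuousLinearMap.opNorm_le_bound (M := η * √(2 * N)) _ (by positivity)
    fun u => ?_) ?_
  · rw [mul_right_comm]
    refine norm_le_of_ae_le_indicator hN (by positivity) ?_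
    rw [sub_apply]
    filter_upwards [sum_rankOne_cell_ae (N := N) hδ k u, mulOp_cutoff_ae N (convOp g u),
      convOp_ae_inner g u, Lp.coeFn_sub (mulOp (cutoff N) (convOp g u))
      ((∑ i ∈ Finset.Icc ⌊-N / δ⌋ ⌊N / δ⌋,
      InnerProductSpace.rankOne ℂ (cell N δ i) (k (i * δ))) u)] with x h1 h2 h3 h4
    rw [ContinuousLinearMap.comp_apply, h4, Pi.sub_apply, h1, h2]
    by_cases hx : x ∈ Set.Icc (-N) N
    · rw [Set.indicator_of_mem hx, Set.indicator_of_mem hx, Set.indicator_of_mem hx, h3,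
        ← inner_sub_left]
      refine (norm_inner_le_norm _ _).trans ?_
      gcongr
      apply hd'
      have h5 : x - ⌊x / δ⌋ * δ = Int.fract (x / δ) * δ := by
        rw [Int.fract]; field_simp
      rw [h5, abs_of_nonneg (by have := Int.fract_nonneg (x / δ); positivity)]
      nlinarith [Int.fract_lt_one (x / δ)]
    · simp [hx]
  · rw [hη, div_mul_eq_mul_div, div_lt_iff₀ (by positivity)]
    nlinarith [Real.sqrt_nonneg (2 * N)]

/-- The compact operators form a closed `*`-algebra, so the generators suffice, and by continuity in
`f` so do those with `f` supported in `[-N, N]`. There `M_f` absorbs the cutoff, and compactness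
survives left multiplication. -/
lemma crossedProduct_le_rankOneClosure {S : L2R →L[ℂ] L2R} (hS : S ∈ crossedProduct) :
    S ∈ rankOneClosure L2R := by
  have h : crossedProduct ≤ compactAlg L2R := by
    refine NonUnitalStarSubalgebra.topologicalClosure_minimal _ ?_ isClosed_rankOneClosure
    refine NonUnitalStarAlgebra.adjoin_le ?_
    rintro _ ⟨f, hf, g, rfl⟩
    change _ ∈ rankOneClosure L2R
    have hc : IsClosed {f : Lp ℂ ∞ (volume : Measure ℝ) |
        mulOp f ∘L convOp g ∈ rankOneClosure L2R} :=
      isClosed_rankOneClosure.preimage (mulOp.continuous.clm_comp continuous_const)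
    refine closure_minimal ?_ hc hf
    rintro f ⟨N, hN⟩
    have e : mulOp f ∘L convOp g = mulOp f * (mulOp (cutoff N) ∘L convOp g) := by
      ext1 u
      change mulOp f (convOp g u) = mulOp f (mulOp (cutoff N) (convOp g u))
      apply Lp.ext
      filter_upwards [mulOp_ae f (convOp g u), mulOp_ae f (mulOp (cutoff N) (convOp g u)),
        mulOp_cutoff_ae N (convOp g u), hN] with x h1 h2 h3 h4
      rw [h1, h2, h3]
      by_cases hx : x ∈ Set.Icc (-(N : ℝ)) N
      · rw [Set.indicator_of_mem hx]
      · rw [h4 hx, zero_mul, zero_mul]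
    change mulOp f ∘L convOp g ∈ rankOneClosure L2R
    rw [e]
    exact mul_mem_rankOneClosure _ (mulOp_cutoff_convOp_mem N.cast_nonneg g)
  exact h hS

open ContinuousLinearMap (adjoint)

/-! ### From strong convergence to norm convergence -/

section Strong

variable {E F ι : Type*} [NormedAddCommGroup E] [NormedSpace ℂ E] [NormedAddCommGroup F]
  [NormedSpace ℂ F] {l : Filter ι}

/-- The vectors on which a family of operators converges to zero. -/
def nullSubmodule (B : ι → E →L[ℂ] F) (l : Filter ι) : Submodule ℂ E where
  carrier := {u | Tendsto (fun i => B i u) l (𝓝 0)}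
  zero_mem' := by simpa using tendsto_const_nhds
  add_mem' := fun {u v} hu hv => by simpa using Tendsto.add hu hv
  smul_mem' := fun c u hu => by simpa using Tendsto.const_smul hu c

/-- The usual approximation argument for uniformly bounded families. It serves for density
arguments, for passing to compact operators, and for the closedness of `A`. -/
lemma isClosed_nullSubmodule {B : ι → E →L[ℂ] F} {C : ℝ} (hB : ∀ᶠ i in l, ‖B i‖ ≤ C) :
    IsClosed (nullSubmodule B l : Set E) := by
  refine isClosed_of_closure_subset fun u hu => ?_
  change Tendsto (fun i => B i u) l (𝓝 0)
  rw [Metric.tendsto_nhds]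
  intro ε hε
  set D := max C 0 + 1 with hD
  have hD0 : 0 < D := by positivity
  obtain ⟨v, hv, huv⟩ := Metric.mem_closure_iff.1 hu (ε / (2 * D)) (by positivity)
  rw [dist_eq_norm, lt_div_iff₀ (by positivity)] at huv
  filter_upwards [hB, (Metric.tendsto_nhds.1 hv) (ε / 2) (by positivity)] with i h1 h2
  rw [dist_zero_right] at h2 ⊢
  have h3 : ‖B i (u - v)‖ ≤ D * ‖u - v‖ :=
    (B i).le_of_opNorm_le (h1.trans ((le_max_left C 0).trans (by linarith))) _
  have h4 : B i u = B i (u - v) + B i v := by rw [map_sub, sub_add_cancel]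
  rw [h4]
  refine (norm_add_le _ _).trans_lt ?_
  linarith

/-- On a rank one operator, composing with `B i` only moves the vector `x` to `B i x`. The
admissible `K` form a closed subspace, as the null space of the bounded family `K ↦ B i ∘L K`. -/
lemma tendsto_comp_of_mem_rankOneClosure {H : Type*} [NormedAddCommGroup H]
    [InnerProductSpace ℂ H] [CompleteSpace H] {B : ι → H →L[ℂ] F} {C : ℝ}
    (hB : ∀ᶠ i in l, ‖B i‖ ≤ C) (h : ∀ u, Tendsto (fun i => B i u) l (𝓝 0)) {K : H →L[ℂ] H}
    (hK : K ∈ rankOneClosure H) : Tendsto (fun i => B i ∘L K) l (𝓝 0) := by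
  have hB' : ∀ᶠ i in l, ‖ContinuousLinearMap.compL ℂ H H F (B i)‖ ≤ C := by
    filter_upwards [hB] with i hi
    exact (ContinuousLinearMap.opNorm_le_bound _ (norm_nonneg _) fun K =>
      ContinuousLinearMap.opNorm_comp_le (B i) K).trans hi
  refine rankOneClosure_le (isClosed_nullSubmodule hB') (fun x y => ?_) hK
  change Tendsto (fun i => B i ∘L InnerProductSpace.rankOne ℂ x y) l (𝓝 0)
  simp only [InnerProductSpace.comp_rankOne]
  rw [tendsto_zero_iff_norm_tendsto_zero]
  simpa using (tendsto_zero_iff_norm_tendsto_zero.1 (h x)).mul_const ‖y‖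

end Strong

/-! ### Strong continuity of `U_t^*` for `t > 0` -/

lemma L2R_mem_of_compactSupport {p : Set L2R} (hp : IsClosed p)
    (h : ∀ (g : ℝ → ℂ) (hc : Continuous g) (hs : HasCompactSupport g),
      (hc.memLp_of_hasCompactSupport (μ := volume) (p := 2) hs).toLp g ∈ p) (u : L2R) : u ∈ p := by
  rw [← hp.closure_eq]
  refine Metric.mem_closure_iff.2 fun ε hε => ?_
  obtain ⟨g, hs, hle, hc, hm⟩ := (Lp.memLp u).exists_hasCompactSupport_eLpNorm_sub_le
    (by norm_num) (ε := ENNReal.ofReal (ε / 2)) (by simpa using hε)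
  refine ⟨_, h g hc hs, ?_⟩
  have e : u = (Lp.memLp u).toLp u := (Lp.toLp_coeFn u _).symm
  rw [e, dist_eq_norm, ← MemLp.toLp_sub, Lp.norm_toLp]
  refine lt_of_le_of_lt (ENNReal.toReal_le_of_le_ofReal (by positivity) hle) (by linarith)

lemma exists_support_bound {g : ℝ → ℂ} (hs : HasCompactSupport g) :
    ∃ N : ℝ, 0 ≤ N ∧ ∀ x, N < |x| → g x = 0 := by
  obtain ⟨R, hR⟩ := hs.isCompact.isBounded.subset_closedBall (0 : ℝ)
  refine ⟨max R 0, le_max_right _ _, fun x hx => ?_⟩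
  by_contra h
  have := hR (subset_tsupport g h)
  rw [Metric.mem_closedBall, Real.dist_eq, sub_zero] at this
  exact absurd hx (not_lt.2 (this.trans (le_max_left _ _)))

lemma hat_nonneg (t : ℝ) (n : ℤ) (x : ℝ) : 0 ≤ hat t n x := by unfold hat; positivity

lemma hat_le (t : ℝ) (n : ℤ) (x : ℝ) : hat t n x ≤ 1 / √t := by
  unfold hat
  refine mul_le_of_le_one_right (by positivity) (max_le zero_le_one ?_)
  linarith [abs_nonneg (x / t - n)]

lemma inner_phi_toLp (t : ℝ) (n : ℤ) {g : ℝ → ℂ} (hg : MemLp g 2 volume) :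
    ⟪phi t n, hg.toLp g⟫_ℂ = ∫ x, (hat t n x : ℂ) * g x := by
  rw [L2.inner_def]
  apply integral_congr_ae
  filter_upwards [(memLp_hat t n).coeFn_toLp, hg.coeFn_toLp] with x h1 h2
  have h1' : phi t n x = (hat t n x : ℂ) := h1
  rw [h1', h2]
  simp [mul_comm]

lemma continuousAt_integral_hat_mul {g : ℝ → ℂ} (hc : Continuous g) (hs : HasCompactSupport g)
    (n : ℤ) {s : ℝ} (h0 : 0 < s) : ContinuousAt (fun t => ∫ x, (hat t n x : ℂ) * g x) s := by
  -- The bound is uniform over `t > s / 2`, a neighbourhood of `s`.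
  refine continuousAt_of_dominated (bound := fun x => 1 / √(s / 2) * ‖g x‖) ?_ ?_ ?_ ?_
  · refine Eventually.of_forall fun t => Continuous.aestronglyMeasurable ?_
    exact (Complex.continuous_ofReal.comp (continuous_hat t n)).mul hc
  · filter_upwards [eventually_gt_nhds (half_lt_self h0)] with t ht
    refine Eventually.of_forall fun x => ?_
    rw [norm_mul, Complex.norm_real, Real.norm_of_nonneg (hat_nonneg _ _ _)]
    gcongr
    refine (hat_le t n x).trans ?_
    gcongr
  · exact (hc.norm.integrable_of_hasCompactSupport hs.norm).const_mul _
  · refine Eventually.of_forall fun x => ?_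
    have : ContinuousAt (fun t => hat t n x) s := by
      unfold hat
      have h1 : √s ≠ 0 := by positivity
      have h2 : s ≠ 0 := h0.ne'
      fun_prop (disch := assumption)
    exact (Complex.continuous_ofReal.continuousAt.comp this).mul continuousAt_const

lemma inner_delta_self (n : ℤ) : ⟪delta n, delta n⟫_ℂ = 1 := by
  rw [inner_delta]; simp [delta]

lemma inner_delta_of_ne {n m : ℤ} (h : n ≠ m) : ⟪delta n, delta m⟫_ℂ = 0 := by
  rw [inner_delta]; simp [delta, h]

lemma adjoint_synthesis_apply (t : ℝ) (v : L2R) (n : ℤ) :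
    adjoint (synthesis t) v n = ⟪phi t n, v⟫_ℂ := by
  rw [← inner_delta, ContinuousLinearMap.adjoint_inner_right, synthesis_delta]

lemma continuousAt_adjoint_synthesis {g : ℝ → ℂ} (hc : Continuous g) (hs : HasCompactSupport g)
    {s : ℝ} (h0 : 0 < s) : ContinuousAt (fun t => adjoint (synthesis t)
      ((hc.memLp_of_hasCompactSupport (μ := volume) (p := 2) hs).toLp g)) s := by
  obtain ⟨N, hN, hg⟩ := exists_support_bound hs
  -- For `t > s / 2` the support of `g` lies in `|x / t| ≤ M - 1`, so hats with `|n| ≥ M` miss it.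
  -- Near `s` the vector is thus a sum over a fixed finite set of indices.
  set M : ℤ := ⌈N / (s / 2)⌉ + 1 with hM
  have h1 : ContinuousAt (fun t => ∑ n ∈ Finset.Icc (-M) M,
      (∫ x, (hat t n x : ℂ) * g x) • delta n) s :=
    tendsto_finsetSum _ fun n _ =>
      (continuousAt_integral_hat_mul hc hs n h0).smul continuousAt_const
  refine h1.congr ?_
  filter_upwards [eventually_gt_nhds (half_lt_self h0)] with t ht
  have ht0 : 0 < t := by linarith
  refine lp.ext (funext fun n => ?_)
  rw [adjoint_synthesis_apply, inner_phi_toLp, ← inner_delta, inner_sum]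
  simp only [inner_smul_right]
  by_cases hn : n ∈ Finset.Icc (-M) M
  · rw [Finset.sum_eq_single n]
    · rw [inner_delta_self, mul_one]
    · intro m _ hm
      rw [inner_delta_of_ne hm.symm, mul_zero]
    · exact fun h => absurd hn h
  · rw [Finset.sum_eq_zero]
    · symm
      rw [← integral_zero ℝ ℂ]
      congr 1
      funext x
      by_cases hx : N < |x|
      · rw [hg x hx, mul_zero]
      · rw [hat_eq_zero, Complex.ofReal_zero, zero_mul]
        have hxt : |x / t| ≤ N / (s / 2) := by
          rw [abs_div, abs_of_pos ht0]
          gcongr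
          exact not_lt.1 hx
        have hxM : |x / t| ≤ M - 1 := by
          rw [hM]; push_cast
          have := Int.le_ceil (N / (s / 2))
          linarith
        have hnM : (M : ℝ) ≤ |(n : ℝ)| := by
          rw [Finset.mem_Icc, ← abs_le, not_le] at hn
          exact_mod_cast hn.le
        have h3 := abs_sub_abs_le_abs_sub (n : ℝ) (x / t)
        rw [abs_sub_comm] at h3
        linarith
    · intro m hm
      have : n ≠ m := fun h => hn (h ▸ hm)
      rw [inner_delta_of_ne this, mul_zero]

lemma adjoint_U (t : ℝ) : adjoint (U t) = cMat ∘L adjoint (synthesis t) := by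
  have h : adjoint cMat = cMat := isSelfAdjoint_invSqrt gram
  rw [U, ContinuousLinearMap.adjoint_comp, h]

lemma eventually_norm_adjoint_U_sub_le {s : ℝ} (h0 : 0 < s) :
    ∀ᶠ t in 𝓝 s, ‖adjoint (U t) - adjoint (U s)‖ ≤ 2 := by
  filter_upwards [eventually_gt_nhds h0] with t ht
  refine (norm_sub_le _ _).trans ?_
  linarith [norm_adjoint_U_le ht, norm_adjoint_U_le h0]

lemma tendsto_adjoint_U_sub {s : ℝ} (h0 : 0 < s) (u : L2R) :
    Tendsto (fun t => (adjoint (U t) - adjoint (U s)) u) (𝓝 s) (𝓝 0) := by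
  refine L2R_mem_of_compactSupport
    (isClosed_nullSubmodule (eventually_norm_adjoint_U_sub_le h0)) (fun g hc hs => ?_) u
  change Tendsto (fun t => (adjoint (U t) - adjoint (U s)) _) (𝓝 s) (𝓝 0)
  simp only [adjoint_U, sub_apply, ContinuousLinearMap.comp_apply]
  rw [tendsto_sub_nhds_zero_iff]
  exact (cMat.continuous.tendsto _).comp (continuousAt_adjoint_synthesis hc hs h0)

/-! ### Strong convergence `P_t → 1` by piecewise linear interpolation -/

/-- The projection `P_t = U_t U_t^*` onto the closed span of the `φ_n^t`. -/
def proj (t : ℝ) : L2R →L[ℂ] L2R := U t ∘L adjoint (U t)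

lemma proj_synthesis {t : ℝ} (ht : 0 < t) (a : l2Z) : proj t (synthesis t a) = synthesis t a := by
  rw [synthesis_eq_U]
  change U t ((adjoint (U t) ∘L U t) _) = _
  rw [adjoint_U_comp ht]
  rfl

lemma norm_proj_le {t : ℝ} (ht : 0 < t) : ‖proj t‖ ≤ 1 :=
  (ContinuousLinearMap.opNorm_comp_le _ _).trans
    (mul_le_one₀ (norm_U_le ht) (norm_nonneg _) (norm_adjoint_U_le ht))

lemma eventually_norm_proj_sub_one_le : ∀ᶠ t in 𝓝[>] (0 : ℝ), ‖proj t - 1‖ ≤ 2 := by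
  filter_upwards [self_mem_nhdsWithin] with t ht
  refine (norm_sub_le _ _).trans ?_
  have h : ‖(1 : L2R →L[ℂ] L2R)‖ ≤ 1 := ContinuousLinearMap.norm_id_le
  linarith [norm_proj_le ht]

/-- The piecewise linear interpolation of `g` at the points `n t`. -/
def interp (t N : ℝ) (g : ℝ → ℂ) : l2Z :=
  ∑ n ∈ Finset.Icc ⌊-N / t⌋ ⌈N / t⌉, (√t * g (n * t)) • delta n

lemma synthesis_interp_ae {t : ℝ} (ht : 0 < t) {N : ℝ} {g : ℝ → ℂ}
    (hg : ∀ x, N < |x| → g x = 0) :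
    synthesis t (interp t N g) =ᵐ[volume] fun x =>
      (1 - Int.fract (x / t)) * g (⌊x / t⌋ * t) + Int.fract (x / t) * g ((⌊x / t⌋ + 1) * t) := by
  have e : synthesis t (interp t N g) =
      ∑ n ∈ Finset.Icc ⌊-N / t⌋ ⌈N / t⌉, (√t * g (n * t)) • phi t n := by
    simp [interp, synthesis_delta]
  rw [e]
  have h1 : ∀ᵐ x : ℝ, ∀ n : ℤ, ((√t * g (n * t)) • phi t n : L2R) x =
      g (n * t) * (max 0 (1 - |x / t - n|) : ℝ) := by
    rw [ae_all_iff]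
    intro n
    filter_upwards [(memLp_hat t n).coeFn_toLp, Lp.coeFn_smul (√t * g (n * t)) (phi t n)]
      with x h1 h2
    have h1' : phi t n x = (hat t n x : ℂ) := h1
    rw [h2, Pi.smul_apply, h1', hat, smul_eq_mul]
    have : (√t : ℂ) ≠ 0 := by
      rw [Ne, Complex.ofReal_eq_zero, Real.sqrt_eq_zero ht.le]; exact ht.ne'
    push_cast
    field_simp
  filter_upwards [h1, Lp.coeFn_finsetSum (Finset.Icc ⌊-N / t⌋ ⌈N / t⌉)
    fun n => (√t * g (n * t)) • phi t n] with x h1 h2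
  rw [h2, Finset.sum_apply]
  simp only [h1]
  set m := ⌊x / t⌋ with hm
  have hfr : x / t = m + Int.fract (x / t) := (Int.floor_add_fract _).symm
  set s := Int.fract (x / t) with hsdef
  have hs0 : 0 ≤ s := Int.fract_nonneg _
  have hs1 : s < 1 := Int.fract_lt_one _
  -- The sum over the interpolation range and the sum over `{m, m + 1}` both equal the sum over the
  -- union: outside the former `g (n t) = 0`, outside the latter the hat vanishes at `x`.
  have hsub1 := Finset.sum_subset (Finset.subset_union_left (s₁ := Finset.Icc ⌊-N / t⌋ ⌈N / t⌉)
    (s₂ := {m, m + 1})) (f := fun n : ℤ => g (n * t) * ((max 0 (1 - |x / t - n|) : ℝ) : ℂ)) (by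
      intro n _ hn
      rw [hg, zero_mul]
      by_contra hle
      rw [not_lt, abs_le] at hle
      apply hn
      rw [Finset.mem_Icc]
      constructor
      · have : -N / t ≤ n := by rw [div_le_iff₀ ht]; exact hle.1
        exact_mod_cast (Int.floor_le _).trans this
      · have : (n : ℝ) ≤ N / t := by rw [le_div_iff₀ ht]; exact hle.2
        exact_mod_cast this.trans (Int.le_ceil _))
  have hsub2 := Finset.sum_subset (Finset.subset_union_right (s₁ := Finset.Icc ⌊-N / t⌋ ⌈N / t⌉)
    (s₂ := {m, m + 1})) (f := fun n : ℤ => g (n * t) * ((max 0 (1 - |x / t - n|) : ℝ) : ℂ)) (by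
      intro n _ hn
      rw [max_eq_left, Complex.ofReal_zero, mul_zero]
      simp only [Finset.mem_insert, Finset.mem_singleton, not_or] at hn
      rw [sub_nonpos, hfr]
      rcases lt_or_gt_of_ne hn.1 with h | h
      · have : (n : ℝ) + 1 ≤ m := by exact_mod_cast h
        exact le_abs.2 (Or.inl (by linarith))
      · have h' : m + 1 < n := lt_of_le_of_ne h (Ne.symm hn.2)
        have : (m : ℝ) + 1 + 1 ≤ n := by exact_mod_cast h'
        exact le_abs.2 (Or.inr (by linarith)))
  rw [hsub1, ← hsub2, Finset.sum_pair (by omega), hfr]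
  have e1 : max 0 (1 - |(m : ℝ) + s - m|) = 1 - s := by
    rw [add_sub_cancel_left, abs_of_nonneg hs0, max_eq_right (by linarith)]
  have e2 : max 0 (1 - |(m : ℝ) + s - (m + 1 : ℤ)|) = s := by
    have : (m : ℝ) + s - (m + 1 : ℤ) = -(1 - s) := by push_cast; ring
    rw [this, abs_neg, abs_of_nonneg (by linarith), max_eq_right] <;> linarith
  rw [e1, e2]
  push_cast
  ring

/-- The interpolant at `x` is a convex combination of values of `g` at two nodes within distance `t`
of `x`. As `t ≤ 1`, the error vanishes outside `[-(N + 1), N + 1]`. -/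
lemma norm_sub_synthesis_interp_le {t : ℝ} (ht : 0 < t) (ht1 : t ≤ 1) {N ω : ℝ} (hN : 0 ≤ N)
    (hω : 0 ≤ ω) {g : ℝ → ℂ} (hm : MemLp g 2 volume) (hg : ∀ x, N < |x| → g x = 0)
    (hmod : ∀ x y, |x - y| ≤ t → ‖g x - g y‖ ≤ ω) :
    ‖hm.toLp g - synthesis t (interp t N g)‖ ≤ ω * √(2 * (N + 1)) := by
  refine norm_le_of_ae_le_indicator (by linarith) hω ?_
  filter_upwards [synthesis_interp_ae ht hg, hm.coeFn_toLp,
    Lp.coeFn_sub (hm.toLp g) (synthesis t (interp t N g))] with x h1 h2 h3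
  rw [h3, Pi.sub_apply, h1, h2]
  set s := Int.fract (x / t) with hsdef
  have hs0 : 0 ≤ s := Int.fract_nonneg _
  have hs1 : s < 1 := Int.fract_lt_one _
  have hfr : x - ⌊x / t⌋ * t = s * t := by
    rw [hsdef, Int.fract]; field_simp
  have a1 : |x - ⌊x / t⌋ * t| ≤ t := by
    rw [hfr, abs_of_nonneg (by positivity)]; nlinarith
  have a2 : |x - (⌊x / t⌋ + 1) * t| ≤ t := by
    have : x - (⌊x / t⌋ + 1) * t = -((1 - s) * t) := by linarith
    rw [this, abs_neg, abs_of_nonneg (mul_nonneg (by linarith) ht.le)]; nlinarith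
  by_cases hx : x ∈ Set.Icc (-(N + 1)) (N + 1)
  · rw [Set.indicator_of_mem hx]
    have e : g x - ((1 - (s : ℂ)) * g (⌊x / t⌋ * t) + s * g ((⌊x / t⌋ + 1) * t)) =
        ((1 - s : ℝ) : ℂ) * (g x - g (⌊x / t⌋ * t)) + s * (g x - g ((⌊x / t⌋ + 1) * t)) := by
      push_cast; ring
    rw [e]
    refine (norm_add_le _ _).trans ?_
    rw [norm_mul, norm_mul, Complex.norm_real, Complex.norm_real, Real.norm_of_nonneg hs0,
      Real.norm_of_nonneg (by linarith)]
    nlinarith [hmod _ _ a1, hmod _ _ a2]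
  · rw [Set.indicator_of_notMem hx]
    rw [Set.mem_Icc, ← abs_le, not_le] at hx
    have b1 := abs_sub_abs_le_abs_sub x (⌊x / t⌋ * t)
    have b2 := abs_sub_abs_le_abs_sub x ((⌊x / t⌋ + 1) * t)
    rw [hg x (by linarith), hg (⌊x / t⌋ * t) (by linarith), hg ((⌊x / t⌋ + 1) * t) (by linarith)]
    simp

lemma tendsto_proj_sub_one (u : L2R) :
    Tendsto (fun t => (proj t - 1) u) (𝓝[>] 0) (𝓝 0) := by
  refine L2R_mem_of_compactSupport
    (isClosed_nullSubmodule eventually_norm_proj_sub_one_le) (fun g hc hs => ?_) u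
  set hm := hc.memLp_of_hasCompactSupport (μ := volume) (p := 2) hs
  change Tendsto (fun t => (proj t - 1) (hm.toLp g)) (𝓝[>] 0) (𝓝 0)
  obtain ⟨N, hN, hg⟩ := exists_support_bound hs
  rw [Metric.tendsto_nhds]
  intro ε hε
  -- The factor `2` is the bound for `‖P_t - 1‖`; since `P_t - 1` kills the interpolant, it acts
  -- only on the interpolation error.
  set ω := ε / (2 * √(2 * (N + 1)) + 1) with hω
  have hω0 : 0 < ω := by positivity
  obtain ⟨δ, hδ, hd⟩ := Metric.uniformContinuous_iff.1
    (hc.uniformContinuous_of_tendsto_cocompact hs.is_zero_at_infty) ω hω0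
  filter_upwards [self_mem_nhdsWithin, nhdsWithin_le_nhds (eventually_lt_nhds hδ),
    nhdsWithin_le_nhds (eventually_lt_nhds (zero_lt_one' ℝ)),
    eventually_norm_proj_sub_one_le] with t ht htd ht1 hle
  rw [dist_zero_right]
  have h1 := norm_sub_synthesis_interp_le ht ht1.le hN hω0.le hm hg fun x y hxy => by
    rw [← dist_eq_norm]
    exact (hd (by rw [Real.dist_eq]; linarith)).le
  have h2 : (proj t - 1) (hm.toLp g) =
      (proj t - 1) (hm.toLp g - synthesis t (interp t N g)) := by
    have : (proj t - 1) (synthesis t (interp t N g)) = 0 := by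
      rw [sub_apply, proj_synthesis ht]
      exact sub_self _
    rw [map_sub, this, sub_zero]
  rw [h2]
  refine ((proj t - 1).le_of_opNorm_le hle _).trans_lt ?_
  have h3 : ω * (2 * √(2 * (N + 1)) + 1) = ε := by rw [hω]; field_simp
  linarith

lemma tendsto_proj_comp {S : L2R →L[ℂ] L2R} (hS : S ∈ rankOneClosure L2R) :
    Tendsto (fun t => proj t ∘L S) (𝓝[>] 0) (𝓝 S) := by
  rw [← tendsto_sub_nhds_zero_iff]
  have := tendsto_comp_of_mem_rankOneClosure
    eventually_norm_proj_sub_one_le tendsto_proj_sub_one hS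
  simp only [ContinuousLinearMap.sub_comp] at this
  exact this

/-! ### The maps `β_t` on compact operators -/

open InnerProductSpace (rankOne)

/-- The map `S ↦ β_t(S)` as a bounded operator. -/
def betaL (t : ℝ) : (L2R →L[ℂ] L2R) →L[ℂ] (l2Z →L[ℂ] l2Z) :=
  ContinuousLinearMap.compL ℂ l2Z L2R l2Z (adjoint (U t)) ∘L
    (ContinuousLinearMap.compL ℂ l2Z L2R L2R).flip (U t)

lemma norm_beta_le {t : ℝ} (ht : 0 < t) (S : L2R →L[ℂ] L2R) : ‖beta t S‖ ≤ ‖S‖ := by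
  refine (ContinuousLinearMap.opNorm_comp_le _ _).trans ?_
  refine (mul_le_of_le_one_left (norm_nonneg _) (norm_adjoint_U_le ht)).trans ?_
  exact (ContinuousLinearMap.opNorm_comp_le _ _).trans
    (mul_le_of_le_one_right (norm_nonneg _) (norm_U_le ht))

lemma norm_betaL_le {t : ℝ} (ht : 0 < t) : ‖betaL t‖ ≤ 1 :=
  ContinuousLinearMap.opNorm_le_bound _ zero_le_one fun S => by
    rw [one_mul]; exact norm_beta_le ht S

lemma beta_rankOne (t : ℝ) (x y : L2R) :
    beta t (rankOne ℂ x y) = rankOne ℂ (adjoint (U t) x) (adjoint (U t) y) := by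
  rw [beta, InnerProductSpace.rankOne_comp, InnerProductSpace.comp_rankOne]

lemma star_beta (t : ℝ) (S : L2R →L[ℂ] L2R) : star (beta t S) = beta t (star S) := by
  simp only [ContinuousLinearMap.star_eq_adjoint, beta, ContinuousLinearMap.adjoint_comp,
    ContinuousLinearMap.adjoint_adjoint]
  rfl

lemma isClosed_uniformRoe : IsClosed (uniformRoe : Set (l2Z →L[ℂ] l2Z)) :=
  finPropAlg.isClosed_topologicalClosure

lemma rankOne_delta_mem (n m : ℤ) : rankOne ℂ (delta n) (delta m) ∈ uniformRoe := by
  refine finPropAlg.le_topologicalClosure ⟨(|n| + |m|).toNat, fun i j h => ?_⟩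
  rw [InnerProductSpace.rankOne_apply, inner_smul_right]
  by_cases h1 : m = j
  · by_cases h2 : i = n
    · subst h1 h2
      exfalso
      have := abs_sub i m
      omega
    · rw [inner_delta_of_ne h2, mul_zero]
  · rw [inner_delta_of_ne h1, zero_mul]

lemma tendsto_rankOne {H ι : Type*} [NormedAddCommGroup H] [InnerProductSpace ℂ H] {l : Filter ι}
    {u v : ι → H} {x y : H} (hu : Tendsto u l (𝓝 x)) (hv : Tendsto v l (𝓝 y)) :
    Tendsto (fun i => rankOne ℂ (u i) (v i)) l (𝓝 (rankOne ℂ x y)) := by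
  have h1 : Tendsto (fun i => rankOne ℂ (u i - x) (v i) + rankOne ℂ x (v i - y)) l (𝓝 (0 + 0)) := by
    refine Tendsto.add ?_ ?_ <;> rw [tendsto_zero_iff_norm_tendsto_zero] <;>
      simp only [InnerProductSpace.norm_rankOne]
    · simpa using (tendsto_zero_iff_norm_tendsto_zero.1 (tendsto_sub_nhds_zero_iff.2 hu)).mul hv.norm
    · simpa using (tendsto_zero_iff_norm_tendsto_zero.1
        (tendsto_sub_nhds_zero_iff.2 hv)).const_mul ‖x‖
  rw [← tendsto_sub_nhds_zero_iff]
  rw [add_zero] at h1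
  refine h1.congr fun i => ?_
  simp only [map_sub, sub_apply]
  abel

/-- Truncating both vectors to finitely many coordinates leaves a matrix with finitely many nonzero
entries, which is a band matrix. -/
lemma rankOne_mem_uniformRoe (x y : l2Z) : rankOne ℂ x y ∈ uniformRoe := by
  refine isClosed_uniformRoe.mem_of_tendsto (tendsto_rankOne (hasSum_delta x) (hasSum_delta y))
    (Eventually.of_forall fun s => ?_)
  simp only [map_sum, map_smul, map_smulₛₗ, _root_.sum_apply, smul_apply]
  exact sum_mem fun n _ => SMulMemClass.smul_mem _ (sum_mem fun m _ =>
    SMulMemClass.smul_mem _ (rankOne_delta_mem m n))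

lemma beta_mem_uniformRoe (t : ℝ) {S : L2R →L[ℂ] L2R} (hS : S ∈ rankOneClosure L2R) :
    beta t S ∈ uniformRoe := by
  refine rankOneClosure_le (p := uniformRoe.toSubmodule.comap (betaL t).toLinearMap)
    (isClosed_uniformRoe.preimage (betaL t).continuous) (fun x y => ?_) hS
  change beta t (rankOne ℂ x y) ∈ uniformRoe
  rw [beta_rankOne]
  exact rankOne_mem_uniformRoe _ _

lemma tendsto_adjoint_U {s : ℝ} (h0 : 0 < s) (u : L2R) :
    Tendsto (fun t => adjoint (U t) u) (𝓝 s) (𝓝 (adjoint (U s) u)) := by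
  rw [← tendsto_sub_nhds_zero_iff]
  exact tendsto_adjoint_U_sub h0 u

/-- On rank one operators `β_t` applies `U_t^*` to both vectors, so strong continuity of `U_t^*`
alone is needed. -/
lemma tendsto_beta {s : ℝ} (h0 : 0 < s) {S : L2R →L[ℂ] L2R} (hS : S ∈ rankOneClosure L2R) :
    Tendsto (fun t => beta t S) (𝓝 s) (𝓝 (beta s S)) := by
  rw [← tendsto_sub_nhds_zero_iff]
  have hb : ∀ᶠ t in 𝓝 s, ‖betaL t - betaL s‖ ≤ (2 : ℝ) := by
    filter_upwards [eventually_gt_nhds h0] with t ht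
    refine (norm_sub_le (betaL t) (betaL s)).trans ?_
    linarith [norm_betaL_le ht, norm_betaL_le h0]
  refine rankOneClosure_le (isClosed_nullSubmodule hb) (fun x y => ?_) hS
  change Tendsto (fun t => beta t (rankOne ℂ x y) - beta s (rankOne ℂ x y)) (𝓝 s) (𝓝 0)
  rw [tendsto_sub_nhds_zero_iff]
  simp only [beta_rankOne]
  exact tendsto_rankOne (tendsto_adjoint_U h0 x) (tendsto_adjoint_U h0 y)

lemma adjoint_proj (t : ℝ) : adjoint (proj t) = proj t := by
  rw [proj, ContinuousLinearMap.adjoint_comp, ContinuousLinearMap.adjoint_adjoint]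

lemma tendsto_comp_proj {S : L2R →L[ℂ] L2R} (hS : S ∈ rankOneClosure L2R) :
    Tendsto (fun t => S ∘L proj t) (𝓝[>] 0) (𝓝 S) := by
  have := (continuous_star.tendsto _).comp (tendsto_proj_comp (star_mem_rankOneClosure hS))
  rw [star_star] at this
  refine this.congr fun t => ?_
  simp [ContinuousLinearMap.star_eq_adjoint, ContinuousLinearMap.adjoint_comp, adjoint_proj]

/-- Since `P_t S P_t = U_t β_t(S) U_t^*`, the norm of `β_t(S)` is squeezed between `‖P_t S P_t‖ →
‖S‖` and `‖S‖`. -/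
lemma tendsto_norm_beta {S : L2R →L[ℂ] L2R} (hS : S ∈ rankOneClosure L2R) :
    Tendsto (fun t => ‖beta t S‖) (𝓝[>] 0) (𝓝 ‖S‖) := by
  have h1 : Tendsto (fun t => proj t ∘L (S ∘L proj t)) (𝓝[>] 0) (𝓝 S) := by
    have h2 : Tendsto (fun t => proj t ∘L (S ∘L proj t - S)) (𝓝[>] 0) (𝓝 0) := by
      refine squeeze_zero_norm' ?_ (tendsto_zero_iff_norm_tendsto_zero.1
        (tendsto_sub_nhds_zero_iff.2 (tendsto_comp_proj hS)))
      filter_upwards [self_mem_nhdsWithin] with t ht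
      exact (ContinuousLinearMap.opNorm_comp_le _ _).trans
        (mul_le_of_le_one_left (norm_nonneg _) (norm_proj_le ht))
    have h3 := h2.add (tendsto_proj_comp hS)
    rw [zero_add] at h3
    refine h3.congr fun t => ?_
    rw [ContinuousLinearMap.comp_sub, sub_add_cancel]
  refine tendsto_of_tendsto_of_tendsto_of_le_of_le' h1.norm tendsto_const_nhds ?_ ?_
  · filter_upwards [self_mem_nhdsWithin] with t ht
    have e : proj t ∘L (S ∘L proj t) = U t ∘L (beta t S ∘L adjoint (U t)) := rfl
    rw [e]
    refine (ContinuousLinearMap.opNorm_comp_le _ _).trans ?_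
    refine (mul_le_of_le_one_left (norm_nonneg _) (norm_U_le ht)).trans ?_
    exact (ContinuousLinearMap.opNorm_comp_le _ _).trans
      (mul_le_of_le_one_right (norm_nonneg _) (norm_adjoint_U_le ht))
  · filter_upwards [self_mem_nhdsWithin] with t ht
    exact norm_beta_le ht S

/-- Asymptotic multiplicativity: `β_t(R) β_t(S) = β_t(R P_t S)`, and compactness of one factor gives
`P_t S → S` in norm. -/
lemma tendsto_beta_mul_sub (R : L2R →L[ℂ] L2R) {S : L2R →L[ℂ] L2R}
    (hS : S ∈ rankOneClosure L2R) :
    Tendsto (fun t => beta t R * beta t S - beta t (R * S)) (𝓝[>] 0) (𝓝 0) := by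
  have h := (tendsto_zero_iff_norm_tendsto_zero.1
    (tendsto_sub_nhds_zero_iff.2 (tendsto_proj_comp hS))).const_mul ‖R‖
  rw [mul_zero] at h
  refine squeeze_zero_norm' ?_ h
  filter_upwards [self_mem_nhdsWithin] with t ht
  have e : beta t R * beta t S - beta t (R * S) = beta t (R * (proj t ∘L S - S)) := by
    have : beta t (R * (proj t ∘L S - S)) = beta t (R * (proj t ∘L S)) - beta t (R * S) := by
      rw [mul_sub]; exact map_sub (betaL t) _ _
    rw [this]; rfl
  rw [e]
  exact (norm_beta_le ht _).trans (norm_mul_le _ _)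

/-! ### Fibres and the product algebra -/

/-- The fibre over `0` as operators on `L²(ℝ)`. -/
def fiberZeroL : Fiber 0 →ₗ[ℂ] L2R →L[ℂ] L2R where
  toFun x := atZero x
  map_add' x y := congrArg Subtype.val (map_add atZero x y)
  map_smul' c x := congrArg Subtype.val (map_smul atZero c x)

/-- The fibre over `t > 0` as operators on `l²(ℤ)`. -/
def fiberPosL (t : Set.Ioc (0 : ℝ) 1) : Fiber (incl t) →ₗ[ℂ] l2Z →L[ℂ] l2Z where
  toFun x := atPos t x
  map_add' x y := congrArg Subtype.val (map_add (atPos t) x y)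
  map_smul' c x := congrArg Subtype.val (map_smul (atPos t) c x)

lemma norm_fiberZeroL (x : Fiber 0) : ‖fiberZeroL x‖ = ‖x‖ :=
  NonUnitalStarAlgHom.norm_map atZero atZero.injective x

lemma norm_fiberPosL (t : Set.Ioc (0 : ℝ) 1) (x : Fiber (incl t)) : ‖fiberPosL t x‖ = ‖x‖ :=
  NonUnitalStarAlgHom.norm_map (atPos t) (atPos t).injective x

/-- The value at `0` of an element of the product, as an operator. -/
def evZero : lp Fiber ∞ →L[ℂ] L2R →L[ℂ] L2R :=
  (fiberZeroL ∘ₗ lp.evalₗ Fiber ∞ 0).mkContinuous 1 fun a => by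
    rw [one_mul, LinearMap.comp_apply, norm_fiberZeroL]
    exact lp.norm_apply_le_norm (by simp) a 0

/-- The value at `t > 0` of an element of the product, as an operator. -/
def evPos (t : Set.Ioc (0 : ℝ) 1) : lp Fiber ∞ →L[ℂ] l2Z →L[ℂ] l2Z :=
  (fiberPosL t ∘ₗ lp.evalₗ Fiber ∞ (incl t)).mkContinuous 1 fun a => by
    rw [one_mul, LinearMap.comp_apply, norm_fiberPosL]
    exact lp.norm_apply_le_norm (by simp) a (incl t)

lemma norm_evZero (a : lp Fiber ∞) : ‖evZero a‖ = ‖a 0‖ := norm_fiberZeroL (a 0)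

lemma norm_evPos (t : Set.Ioc (0 : ℝ) 1) (a : lp Fiber ∞) : ‖evPos t a‖ = ‖a (incl t)‖ :=
  norm_fiberPosL t (a (incl t))

lemma norm_evPos_le (t : Set.Ioc (0 : ℝ) 1) : ‖evPos t‖ ≤ 1 :=
  LinearMap.mkContinuous_norm_le _ zero_le_one _

lemma norm_evZero_le : ‖evZero‖ ≤ 1 := LinearMap.mkContinuous_norm_le _ zero_le_one _

lemma evZero_mul (a b : lp Fiber ∞) : evZero (a * b) = evZero a * evZero b :=
  congrArg Subtype.val (map_mul atZero (a 0) (b 0))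

lemma evZero_star (a : lp Fiber ∞) : evZero (star a) = star (evZero a) :=
  congrArg Subtype.val (map_star atZero (a 0))

lemma evPos_mul (t : Set.Ioc (0 : ℝ) 1) (a b : lp Fiber ∞) :
    evPos t (a * b) = evPos t a * evPos t b :=
  congrArg Subtype.val (map_mul (atPos t) (a (incl t)) (b (incl t)))

lemma evPos_star (t : Set.Ioc (0 : ℝ) 1) (a : lp Fiber ∞) :
    evPos t (star a) = star (evPos t a) :=
  congrArg Subtype.val (map_star (atPos t) (a (incl t)))

lemma evPos_mem (t : Set.Ioc (0 : ℝ) 1) (a : lp Fiber ∞) : evPos t a ∈ uniformRoe :=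
  (atPos t (a (incl t))).2

lemma evZero_mem (a : lp Fiber ∞) : evZero a ∈ rankOneClosure L2R :=
  crossedProduct_le_rankOneClosure (atZero (a 0)).2

lemma eq_zero_or_eq_incl (t : unitInterval) : t = 0 ∨ ∃ s, t = incl s := by
  rcases eq_or_ne t 0 with h | h
  · exact Or.inl h
  · exact Or.inr ⟨⟨t, lt_of_le_of_ne t.2.1 fun h' => h (Subtype.ext h'.symm), t.2.2⟩, rfl⟩

lemma incl_injective : Function.Injective incl := fun _ _ h =>
  Subtype.ext (congrArg (fun t : unitInterval => (t : ℝ)) h)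

lemma exists_family (S : crossedProduct) (h : Set.Ioc (0 : ℝ) 1 → uniformRoe) {C : ℝ}
    (hC : ∀ t, ‖h t‖ ≤ C) :
    ∃ a : lp Fiber ∞, atZero (a 0) = S ∧ ∀ t, atPos t (a (incl t)) = h t := by
  -- Quantifying over the equalities `t = 0` and `t = incl s` gives one statement for all `t`, from
  -- which the family is chosen.
  have hex : ∀ t : unitInterval, ∃ x : Fiber t, (∀ h0 : t = 0, atZero (h0 ▸ x) = S) ∧
      (∀ s (hs : t = incl s), atPos s (hs ▸ x) = h s) ∧ ‖x‖ ≤ max C ‖S‖ := by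
    intro t
    rcases eq_zero_or_eq_incl t with rfl | ⟨s, rfl⟩
    · refine ⟨atZero.symm S, fun _ => atZero.apply_symm_apply S,
        fun s hs => absurd hs.symm (incl_ne_zero s), ?_⟩
      refine le_trans (le_of_eq ?_) (le_max_right _ _)
      rw [← norm_fiberZeroL]
      exact congrArg norm (congrArg Subtype.val (atZero.apply_symm_apply S))
    · refine ⟨(atPos s).symm (h s), fun h0 => absurd h0 (incl_ne_zero s), fun s' hs => ?_, ?_⟩
      · obtain rfl := incl_injective hs
        exact (atPos s).apply_symm_apply _
      · refine le_trans (le_of_eq ?_) ((hC s).trans (le_max_left _ _))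
        rw [← norm_fiberPosL]
        exact congrArg norm (congrArg Subtype.val ((atPos s).apply_symm_apply (h s)))
  choose x hx0 hx1 hx2 using hex
  exact ⟨⟨x, memℓp_infty ⟨_, Set.forall_mem_range.2 hx2⟩⟩, hx0 0 rfl, fun t => hx1 _ t rfl⟩

/-- Compact subsets of `(0, 1]` stay away from `0`, and each `[ε, 1]` is compact; so vanishing at
infinity means tending to zero as `t → 0`. -/
lemma cocompact_Ioc : cocompact (Set.Ioc (0 : ℝ) 1) = comap Subtype.val (𝓝[>] 0) := by
  apply le_antisymm
  · intro s hs
    obtain ⟨u, hu, hus⟩ := mem_comap.1 hs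
    obtain ⟨ε, hε, h⟩ := mem_nhdsGT_iff_exists_Ioo_subset.1 hu
    refine mem_cocompact.2 ⟨{t | ε ≤ t}, ?_, fun t ht => hus (h ⟨t.2.1, not_le.1 ht⟩)⟩
    rw [Subtype.isCompact_iff]
    have e : Subtype.val '' {t : Set.Ioc (0 : ℝ) 1 | ε ≤ t} = Set.Icc ε 1 := by
      ext x
      constructor
      · rintro ⟨t, ht, rfl⟩; exact ⟨ht, t.2.2⟩
      · rintro ⟨h1, h2⟩; exact ⟨⟨x, lt_of_lt_of_le hε h1, h2⟩, h1, rfl⟩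
    rw [e]
    exact isCompact_Icc
  · intro s hs
    obtain ⟨K, hK, hKs⟩ := mem_cocompact.1 hs
    have hK' := (hK.image continuous_subtype_val).isClosed
    have h0 : (0 : ℝ) ∈ (Subtype.val '' K)ᶜ := by
      rintro ⟨t, _, ht⟩; exact t.2.1.ne' ht
    exact mem_comap.2 ⟨_, nhdsWithin_le_nhds (hK'.isOpen_compl.mem_nhds h0),
      fun t ht => hKs fun htK => ht ⟨t, htK, rfl⟩⟩

lemma tendsto_val_cocompact :
    Tendsto (Subtype.val : Set.Ioc (0 : ℝ) 1 → ℝ) (cocompact _) (𝓝[>] 0) := by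
  rw [cocompact_Ioc]; exact tendsto_comap

instance neBot_cocompact_Ioc : NeBot (cocompact (Set.Ioc (0 : ℝ) 1)) := by
  rw [cocompact_Ioc]
  refine NeBot.comap_of_range_mem inferInstance ?_
  rw [Subtype.range_coe]
  exact Ioc_mem_nhdsGT zero_lt_one

/-! ### The section algebra -/

/-- The elements of the product which are continuous on `(0, 1]` and asymptotic to `β^S` at `0`,
where `S` is the value at `0`. -/
def sectionSubmodule : Submodule ℂ (lp Fiber ∞) :=
  (⨅ s, nullSubmodule (fun t => evPos t - evPos s) (𝓝 s)) ⊓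
    nullSubmodule (fun t : Set.Ioc (0 : ℝ) 1 => evPos t - betaL t ∘L evZero) (cocompact _)

lemma mem_sectionSubmodule {a : lp Fiber ∞} : a ∈ sectionSubmodule ↔
    Continuous (fun t => evPos t a) ∧
      Tendsto (fun t => evPos t a - beta t (evZero a)) (cocompact _) (𝓝 0) := by
  rw [sectionSubmodule, Submodule.mem_inf, Submodule.mem_iInf]
  refine and_congr ?_ Iff.rfl
  rw [continuous_iff_continuousAt]
  exact forall_congr' fun s => tendsto_sub_nhds_zero_iff

/-- Both defining conditions say that a family of operators of norm at most `2` tends to zero at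
`a`. -/
lemma isClosed_sectionSubmodule : IsClosed (sectionSubmodule : Set (lp Fiber ∞)) := by
  rw [sectionSubmodule, Submodule.coe_inf, Submodule.coe_iInf]
  refine IsClosed.inter (isClosed_iInter fun s => ?_) ?_
  · refine isClosed_nullSubmodule (C := 2) (Eventually.of_forall fun t => ?_)
    refine (norm_sub_le (evPos t) (evPos s)).trans ?_
    linarith [norm_evPos_le t, norm_evPos_le s]
  · refine isClosed_nullSubmodule (C := 2) (Eventually.of_forall fun t => ?_)
    refine (norm_sub_le (evPos t) _).trans ?_
    have h1 := (betaL t).opNorm_comp_le evZero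
    have h2 : ‖betaL t‖ * ‖evZero‖ ≤ 1 :=
      mul_le_one₀ (norm_betaL_le t.2.1) (norm_nonneg evZero) norm_evZero_le
    linarith [norm_evPos_le t]

lemma continuous_beta {S : L2R →L[ℂ] L2R} (hS : S ∈ rankOneClosure L2R) :
    Continuous fun t : Set.Ioc (0 : ℝ) 1 => beta t S :=
  continuous_iff_continuousAt.2 fun s =>
    (tendsto_beta s.2.1 hS).comp (continuous_subtype_val.tendsto s)

lemma isSection_iff {a : lp Fiber ∞} {f : C₀(Set.Ioc (0 : ℝ) 1, uniformRoe)} {S : crossedProduct} :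
    IsSection a f S ↔ atZero (a 0) = S ∧ ∀ t : Set.Ioc (0 : ℝ) 1,
      evPos t a = (f t : l2Z →L[ℂ] l2Z) + beta t S := Iff.rfl

lemma tendsto_coe_zeroAtInfty (f : C₀(Set.Ioc (0 : ℝ) 1, uniformRoe)) :
    Tendsto (fun t => (f t : l2Z →L[ℂ] l2Z)) (cocompact _) (𝓝 0) :=
  (continuous_subtype_val.tendsto (0 : uniformRoe)).comp f.zero_at_infty'

/-- The function `f` is recovered as `a(t) - β_t(a(0))`, which takes values in `C*_u(ℤ)` because
`a(0)` is compact. -/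
lemma coe_sectionSubmodule : (sectionSubmodule : Set (lp Fiber ∞)) = sectionSet := by
  ext a
  rw [SetLike.mem_coe, mem_sectionSubmodule]
  constructor
  · rintro ⟨h1, h2⟩
    have hb := continuous_beta (evZero_mem a)
    refine ⟨⟨⟨fun t => ⟨evPos t a - beta t (evZero a),
      sub_mem (evPos_mem t a) (beta_mem_uniformRoe t (evZero_mem a))⟩, ?_⟩, ?_⟩, atZero (a 0),
      isSection_iff.2 ⟨rfl, fun t => ?_⟩⟩
    · exact (h1.sub hb).subtype_mk _
    · rw [tendsto_subtype_rng]
      exact h2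
    · exact (sub_add_cancel (evPos t a) (beta t (evZero a))).symm
  · rintro ⟨f, S, hf⟩
    obtain ⟨h0, h1⟩ := isSection_iff.1 hf
    have h0' : evZero a = S := congrArg Subtype.val h0
    simp only [h0', h1, add_sub_cancel_right]
    exact ⟨(continuous_subtype_val.comp f.continuous).add
      (continuous_beta (crossedProduct_le_rankOneClosure S.2)), tendsto_coe_zeroAtInfty f⟩

lemma norm_evPos_apply_le (t : Set.Ioc (0 : ℝ) 1) (a : lp Fiber ∞) : ‖evPos t a‖ ≤ ‖a‖ := by
  simpa using (evPos t).le_of_opNorm_le (norm_evPos_le t) a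

lemma mul_mem_sectionSubmodule {a b : lp Fiber ∞} (ha : a ∈ sectionSubmodule)
    (hb : b ∈ sectionSubmodule) : a * b ∈ sectionSubmodule := by
  rw [mem_sectionSubmodule] at *
  simp only [evPos_mul, evZero_mul]
  refine ⟨ha.1.mul hb.1, ?_⟩
  -- With `R = a(0)` and `S = b(0)`, the difference `ab - β(RS)` splits as `(a - β(R)) b + β(R) (b -
  -- β(S)) + (β(R) β(S) - β(RS))`.
  have h1 := ha.2.zero_mul_isBoundedUnder_le (g := fun t => evPos t b)
    (isBoundedUnder_of ⟨‖b‖, fun t => norm_evPos_apply_le t b⟩)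
  have h2 := isBoundedUnder_le_mul_tendsto_zero
    (f := fun t : Set.Ioc (0 : ℝ) 1 => beta t (evZero a))
    (isBoundedUnder_of ⟨‖evZero a‖, fun t => norm_beta_le t.2.1 _⟩) hb.2
  have h3 := (tendsto_beta_mul_sub (evZero a) (evZero_mem b)).comp tendsto_val_cocompact
  have h4 := (h1.add h2).add h3
  rw [add_zero, add_zero] at h4
  refine h4.congr fun t => ?_
  simp only [Function.comp_apply]
  noncomm_ring

lemma star_mem_sectionSubmodule {a : lp Fiber ∞} (ha : a ∈ sectionSubmodule) :
    star a ∈ sectionSubmodule := by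
  rw [mem_sectionSubmodule] at *
  simp only [evPos_star, evZero_star, ← star_beta, ← star_sub]
  refine ⟨ha.1.star, ?_⟩
  simpa using ha.2.star

/-- The C*-algebra `A = C_0((0,1]; C*_u(ℤ)) + {β^S : S ∈ A_0}`. -/
def sectionAlg : NonUnitalStarSubalgebra ℂ (lp Fiber ∞) where
  __ := sectionSubmodule
  mul_mem' := mul_mem_sectionSubmodule
  star_mem' := star_mem_sectionSubmodule

/-- The evaluation of sections at `t`. -/
def evalHom (t : unitInterval) : sectionAlg →⋆ₙₐ[ℂ] Fiber t where
  toFun a := (a : lp Fiber ∞) t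
  map_smul' _ _ := rfl
  map_zero' := rfl
  map_add' _ _ := rfl
  map_mul' _ _ := rfl
  map_star' _ := rfl

/-! ### Continuity of the norm, surjectivity and uniqueness -/

lemma tendsto_norm_evPos {a : lp Fiber ∞} (ha : a ∈ sectionSubmodule) :
    Tendsto (fun t => ‖evPos t a‖) (cocompact _) (𝓝 ‖evZero a‖) := by
  have h1 := (tendsto_norm_beta (evZero_mem a)).comp tendsto_val_cocompact
  have h2 := (mem_sectionSubmodule.1 ha).2.norm
  rw [norm_zero] at h2
  refine tendsto_of_tendsto_of_dist h1 (squeeze_zero (fun _ => dist_nonneg) (fun t => ?_) h2)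
  rw [dist_comm]
  exact abs_norm_sub_norm_le _ _

lemma isOpenEmbedding_incl : IsOpenEmbedding incl := by
  have h : IsEmbedding incl := IsEmbedding.of_comp (by unfold incl; fun_prop)
    continuous_subtype_val IsEmbedding.subtypeVal
  refine ⟨h, ?_⟩
  have : Set.range incl = {0}ᶜ := by
    ext t
    refine ⟨?_, fun ht => ?_⟩
    · rintro ⟨s, rfl⟩; exact incl_ne_zero s
    · rcases eq_zero_or_eq_incl t with h | ⟨s, rfl⟩
      · exact absurd h ht
      · exact ⟨s, rfl⟩
  rw [this]
  exact isOpen_compl_singleton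

lemma continuous_norm_evalHom (a : sectionAlg) : Continuous fun t => ‖evalHom t a‖ := by
  have hpos : ∀ t, ‖evPos t a‖ = ‖evalHom (incl t) a‖ := fun t => norm_evPos t a
  have hzero : ‖evZero a‖ = ‖evalHom 0 a‖ := norm_evZero a
  rw [continuous_iff_continuousAt]
  intro t
  rcases eq_zero_or_eq_incl t with rfl | ⟨s, rfl⟩
  · have h := tendsto_norm_evPos a.2
    rw [cocompact_Ioc] at h
    simp only [hpos, hzero] at h
    rw [ContinuousAt, Metric.tendsto_nhds]
    intro ε hε
    obtain ⟨u, hu, hus⟩ := mem_comap.1 ((Metric.tendsto_nhds.1 h) ε hε)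
    obtain ⟨δ, hδ, hd⟩ := mem_nhdsGT_iff_exists_Ioo_subset.1 hu
    have hlt : ∀ᶠ t : unitInterval in 𝓝 0, (t : ℝ) < δ :=
      (continuous_subtype_val.tendsto (0 : unitInterval)).eventually (eventually_lt_nhds hδ)
    filter_upwards [hlt] with t ht
    rcases eq_zero_or_eq_incl t with rfl | ⟨s, rfl⟩
    · rwa [dist_self]
    · exact hus (hd ⟨s.2.1, ht⟩ : (s : ℝ) ∈ u)
  · rw [← isOpenEmbedding_incl.continuousAt_iff]
    have := (mem_sectionSubmodule.1 a.2).1.norm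
    simp only [hpos] at this
    exact this.continuousAt

lemma exists_isSection (f : C₀(Set.Ioc (0 : ℝ) 1, uniformRoe)) (S : crossedProduct) :
    ∃ a : lp Fiber ∞, IsSection a f S := by
  obtain ⟨a, h0, h1⟩ := exists_family S
    (fun t => f t + ⟨beta t S, beta_mem_uniformRoe t (crossedProduct_le_rankOneClosure S.2)⟩)
    (C := ‖f‖ + ‖S‖) fun t => (norm_add_le _ _).trans
      (add_le_add (f.toBCF.norm_coe_le_norm t) (norm_beta_le t.2.1 _))
  exact ⟨a, h0, fun t => congrArg Subtype.val (h1 t)⟩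

lemma surjective_evalHom (t : unitInterval) : Function.Surjective (evalHom t) := by
  intro x
  rcases eq_zero_or_eq_incl t with rfl | ⟨s, rfl⟩
  · obtain ⟨a, ha⟩ := exists_isSection 0 (atZero x)
    have ha' : a ∈ sectionSet := ⟨_, _, ha⟩
    rw [← coe_sectionSubmodule] at ha'
    exact ⟨⟨a, ha'⟩, atZero.injective ha.1⟩
  -- The ramp `t ↦ (t / s) x` takes the value `x` at `s` and vanishes at `0`, so it is a section
  -- with `S = 0`.
  · obtain ⟨a, h0, h1⟩ := exists_family 0
      (fun t => ((t / s : ℝ) : ℂ) • atPos s x) (C := 1 / s * ‖atPos s x‖) fun t => by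
        rw [norm_smul, Complex.norm_real,
          Real.norm_of_nonneg (div_nonneg t.2.1.le s.2.1.le)]
        gcongr
        · exact s.2.1.le
        · exact t.2.2
    have e0 : evZero a = 0 := congrArg Subtype.val h0
    have e1 : ∀ t : Set.Ioc (0 : ℝ) 1,
        evPos t a = ((t / s : ℝ) : ℂ) • (atPos s x : l2Z →L[ℂ] l2Z) :=
      fun t => congrArg Subtype.val (h1 t)
    have hc : Continuous fun t : ℝ => ((t / s : ℝ) : ℂ) • (atPos s x : l2Z →L[ℂ] l2Z) := by
      fun_prop
    have ha : a ∈ sectionSubmodule := by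
      rw [mem_sectionSubmodule]
      simp only [e0, e1]
      refine ⟨hc.comp continuous_subtype_val, ?_⟩
      have h2 := ((hc.tendsto 0).mono_left nhdsWithin_le_nhds).comp tendsto_val_cocompact
      have h3 : ∀ t, beta t 0 = 0 := fun t => map_zero (betaL t)
      simp only [h3, sub_zero]
      rwa [zero_div, Complex.ofReal_zero, zero_smul] at h2
    refine ⟨⟨a, ha⟩, (atPos s).injective ((h1 s).trans ?_)⟩
    rw [div_self s.2.1.ne', Complex.ofReal_one, one_smul]
    rfl

lemma isContinuousField_evalHom {_ : IsClosed (sectionAlg : Set (lp Fiber ∞))} :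
    IsContinuousField evalHom where
  surjective := surjective_evalHom
  faithful _ h := Subtype.ext (lp.ext (funext h))
  continuous_norm := continuous_norm_evalHom

/-- The norm of `β_t(S₁ - S₂) = f₂(t) - f₁(t)` tends both to `‖S₁ - S₂‖` and to `0` as `t → 0`. -/
lemma section_unique {f₁ f₂ : C₀(Set.Ioc (0 : ℝ) 1, uniformRoe)} {S₁ S₂ : crossedProduct}
    (h : ∀ t : Set.Ioc (0 : ℝ) 1,
      (f₁ t : l2Z →L[ℂ] l2Z) + beta t S₁ = (f₂ t : l2Z →L[ℂ] l2Z) + beta t S₂) :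
    f₁ = f₂ ∧ S₁ = S₂ := by
  have hS : S₁ = S₂ := by
    have h1 := (tendsto_norm_beta (crossedProduct_le_rankOneClosure (S₁ - S₂).2)).comp
      tendsto_val_cocompact
    have h2 := ((tendsto_coe_zeroAtInfty f₂).sub (tendsto_coe_zeroAtInfty f₁)).norm
    have h4 := tendsto_nhds_unique h1 (h2.congr fun t => by
      have e : beta t (S₁ - S₂ : crossedProduct) = beta t S₁ - beta t S₂ := map_sub (betaL t) _ _
      rw [Function.comp_apply, e, eq_sub_of_add_eq' (h t)]
      congr 1
      abel)
    rw [← sub_eq_zero, ← norm_eq_zero]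
    exact h4.trans (by rw [sub_zero, norm_zero])
  refine ⟨?_, hS⟩
  subst hS
  ext1 t
  exact Subtype.ext (add_right_cancel (h t))

end RoeField

end

open RoeField in
theorem mainTheorem1 :
    -- `β_t` maps `A_0` to `C*_u(ℤ)` for `0 < t ≤ 1`
    (∀ (t : Set.Ioc (0 : ℝ) 1) (S : crossedProduct), beta t S ∈ uniformRoe) ∧
    -- every `f + β^S` is an element of the product of the fibres
    (∀ (f : C₀(Set.Ioc (0 : ℝ) 1, uniformRoe)) (S : crossedProduct),
      ∃ a : lp Fiber ∞, IsSection a f S) ∧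
    -- the functions `f + β^S` on `(0, 1]` determine `f` and `S`
    (∀ (f₁ f₂ : C₀(Set.Ioc (0 : ℝ) 1, uniformRoe)) (S₁ S₂ : crossedProduct),
      (∀ t : Set.Ioc (0 : ℝ) 1,
        (f₁ t : l2Z →L[ℂ] l2Z) + beta t S₁ = (f₂ t : l2Z →L[ℂ] l2Z) + beta t S₂) →
      f₁ = f₂ ∧ S₁ = S₂) ∧
    -- the set of all `f + β^S` is a C*-algebra `A`, and `([0,1], A, π_t)` is a continuous field
    ∃ (A : NonUnitalStarSubalgebra ℂ (lp Fiber ∞)) (_ : IsClosed (A : Set (lp Fiber ∞))),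
      (A : Set (lp Fiber ∞)) = sectionSet ∧
      ∃ π : ∀ t : unitInterval, A →⋆ₙₐ[ℂ] Fiber t,
        (∀ (a : A) (f : C₀(Set.Ioc (0 : ℝ) 1, uniformRoe)) (S : crossedProduct),
          IsSection a f S →
          atZero (π 0 a) = S ∧
          ∀ t : Set.Ioc (0 : ℝ) 1,
            ((atPos t (π (incl t) a) : uniformRoe) : l2Z →L[ℂ] l2Z) =
              (f t : l2Z →L[ℂ] l2Z) + beta t S) ∧
        IsContinuousField π :=
  ⟨fun t S => beta_mem_uniformRoe t (crossedProduct_le_rankOneClosure S.2), exists_isSection,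
    fun _ _ _ _ => section_unique, sectionAlg, isClosed_sectionSubmodule, coe_sectionSubmodule,
    evalHom, fun _ _ _ h => h, isContinuousField_evalHom⟩
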